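/- Let $\mathcal A$ be a (finite) von Neumann algebra on a complex Hilbert space, let $\tau$ be a normalised faithful normal trace on $\mathcal A$ (a faithful normal state with $\tau(xy)=\tau(yx)$ for all $x,y\in\mathcal A$), and let $\varphi$ be a faithful normal state of $\mathcal A$. Then there is a unique positive, non-singular, self-adjoint (in general unbounded) operator $\rho$ affiliated with $\mathcal A$ such that $\varphi(x)=\tau(\rho x)$ for all $x\in\mathcal A$, where $\tau(\rho x)=\lim_{\varepsilon\to 0^+}\tau\big(\rho(1+\varepsilon\rho)^{-1}x\big)$. Define the entropy $$S_\tau(\varphi)=-\tau(\rho\log\rho)=-\int_{[0,\infty)}s\log s\;d\tau(e_s)\in[-\infty,\infty),$$ where $\rho=\int s\,de_s$ is the spectral resolution of $\rho$. Then $$S_\tau(\varphi)\le 0,$$ and $S_\tau(\varphi)=0$ if and only if $\varphi=\tau$. The value $S_\tau(\varphi)=-\infty$ is possible: it occurs for some $\mathcal A$, $\tau$ and $\varphi$ as above. -/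

import Mathlib

open Filter Topology MeasureTheory

noncomputable section

section States

variable {H : Type*} [NormedAddCommGroup H] [InnerProductSpace ℂ H] [CompleteSpace H]

/-- The σ-weak (ultraweak) topology on a von Neumann algebra `A` acting on `H`: the weak topology
induced by the functionals `x ↦ ∑ₙ ⟪ξₙ, x ηₙ⟫`, where `∑ₙ ‖ξₙ‖² < ∞` and `∑ₙ ‖ηₙ‖² < ∞`. -/
abbrev sigmaWeakTopology (A : VonNeumannAlgebra H) : TopologicalSpace A.toStarSubalgebra :=
  ⨅ (ξ : lp (fun _ : ℕ => H) 2) (η : lp (fun _ : ℕ => H) 2),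
    TopologicalSpace.induced
      (fun x : A.toStarSubalgebra => ∑' n, inner ℂ (ξ n) ((x : H →L[ℂ] H) (η n))) inferInstance

/-- `φ` is a faithful normal state of `A`: it is positive, `φ(1) = 1`, `φ(x* x) = 0` only for
`x = 0`, and `φ` is σ-weakly continuous. -/
structure IsFaithfulNormalState (A : VonNeumannAlgebra H)
    (φ : A.toStarSubalgebra →ₗ[ℂ] ℂ) : Prop where
  nonneg : ∀ x, 0 ≤ (φ (star x * x)).re ∧ (φ (star x * x)).im = 0
  map_one : φ 1 = 1
  faithful : ∀ x, φ (star x * x) = 0 → x = 0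
  normal : @Continuous _ _ (sigmaWeakTopology A) _ φ

/-- The trace property `φ(xy) = φ(yx)`. -/
def IsTracial (A : VonNeumannAlgebra H) (φ : A.toStarSubalgebra →ₗ[ℂ] ℂ) : Prop :=
  ∀ x y, φ (x * y) = φ (y * x)

open Classical in
/-- The value of the functional `τ` of `A` at a bounded operator `b` that belongs to `A`.
(The value `0` for `b ∉ A` is a convention that is never used for operators affiliated
with `A`.) -/
def evalOp (A : VonNeumannAlgebra H) (τ : A.toStarSubalgebra →ₗ[ℂ] ℂ) (b : H →L[ℂ] H) : ℂ :=
  if h : b ∈ A.toStarSubalgebra then τ ⟨b, h⟩ else 0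

end States

section AffiliatedOperators

variable {H : Type*} [NormedAddCommGroup H] [InnerProductSpace ℂ H]

/-- `ρ` is a positive self-adjoint operator, in general unbounded. -/
structure IsPositiveOperator [CompleteSpace H] (ρ : H →ₗ.[ℂ] H) : Prop where
  selfAdjoint : IsSelfAdjoint ρ
  nonneg : ∀ ξ : ρ.domain, 0 ≤ (inner ℂ (ξ : H) (ρ ξ)).re

/-- `ρ` is affiliated with `A`: every `y` in the commutant of `A` satisfies `y ρ ⊆ ρ y`. -/
def IsAffiliated [CompleteSpace H] (A : VonNeumannAlgebra H) (ρ : H →ₗ.[ℂ] H) : Prop :=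
  ∀ y ∈ A.commutant, ∀ ξ η : H, (ξ, η) ∈ ρ.graph → (y ξ, y η) ∈ ρ.graph

/-- `a` is the bounded inverse of `1 + ε ρ`, i.e. `{(ζ, a ζ)}` is the set of all pairs
`((1 + ε ρ) ξ, ξ)` with `ξ` in the domain of `ρ`. -/
def IsResolvent (ρ : H →ₗ.[ℂ] H) (ε : ℝ) (a : H →L[ℂ] H) : Prop :=
  ∀ ζ ξ : H, a ζ = ξ ↔ ∃ η, (ξ, η) ∈ ρ.graph ∧ ζ = ξ + (ε : ℂ) • η

theorem IsResolvent.unique {ρ : H →ₗ.[ℂ] H} {ε : ℝ} {a b : H →L[ℂ] H}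
    (ha : IsResolvent ρ ε a) (hb : IsResolvent ρ ε b) : a = b := by
  ext ζ
  exact ((hb ζ (a ζ)).2 ((ha ζ (a ζ)).1 rfl)).symm

/-- For a positive self-adjoint `ρ` and `ε > 0` the bounded operator `(1 + ε ρ)⁻¹` exists. -/
theorem IsPositiveOperator.exists_resolvent [CompleteSpace H] {ρ : H →ₗ.[ℂ] H}
    (h : IsPositiveOperator ρ) {ε : ℝ} (hε : 0 < ε) : ∃ a, IsResolvent ρ ε a := by
  let L : H × H →L[ℂ] H :=
    ContinuousLinearMap.fst ℂ H H + (ε : ℂ) • ContinuousLinearMap.snd ℂ H H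
  have hL : ∀ p : H × H, L p = p.1 + (ε : ℂ) • p.2 := fun p => rfl
  have hpos : ∀ p ∈ ρ.graph, 0 ≤ (inner ℂ p.1 p.2).re := by
    rintro ⟨ξ, η⟩ hp
    obtain ⟨x, hx, hy⟩ := (LinearPMap.mem_graph_iff _).1 hp
    simp only at hx hy ⊢
    rw [← hx, ← hy]
    exact h.nonneg x
  have hsq : ∀ p ∈ ρ.graph, ‖p.1‖ ^ 2 + ε ^ 2 * ‖p.2‖ ^ 2 ≤ ‖L p‖ ^ 2 := by
    intro p hp
    have h1 := norm_add_sq (𝕜 := ℂ) p.1 ((ε : ℂ) • p.2)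
    rw [hL, h1, inner_smul_right, norm_smul, mul_pow]
    have h2 := mul_nonneg hε.le (hpos p hp)
    simp only [Complex.norm_real, Real.norm_eq_abs, sq_abs, RCLike.re_to_complex,
      Complex.re_ofReal_mul]
    linarith
  have hfst : ∀ p ∈ ρ.graph, ‖p.1‖ ≤ ‖L p‖ := fun p hp => by
    have := hsq p hp
    have h2 : 0 ≤ ε ^ 2 * ‖p.2‖ ^ 2 := by positivity
    exact abs_le_of_sq_le_sq' (by linarith) (norm_nonneg _) |>.2
  have hsnd : ∀ p ∈ ρ.graph, ‖p.2‖ ≤ ε⁻¹ * ‖L p‖ := fun p hp => by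
    have := hsq p hp
    have h2 : (ε * ‖p.2‖) ^ 2 ≤ ‖L p‖ ^ 2 := by
      rw [mul_pow]; nlinarith [sq_nonneg ‖p.1‖]
    have h3 := abs_le_of_sq_le_sq' h2 (norm_nonneg _) |>.2
    rw [inv_mul_eq_div, le_div_iff₀ hε]
    linarith
  have hcl : IsClosed (ρ.graph : Set (H × H)) := h.selfAdjoint.isClosed
  have : CompleteSpace ρ.graph := hcl.completeSpace_coe
  let T : ρ.graph →L[ℂ] H := L.comp ρ.graph.subtypeL
  have hT : AntilipschitzWith (Real.toNNReal (max 1 ε⁻¹)) T := by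
    refine ContinuousLinearMap.antilipschitz_of_bound T fun p => ?_
    rw [Real.coe_toNNReal _ (by positivity)]
    have e1 := hfst p p.2
    have e2 := hsnd p p.2
    change ‖(p : H × H)‖ ≤ _ * ‖L p‖
    rw [Prod.norm_def]
    refine max_le (e1.trans ?_) (e2.trans ?_)
    · exact le_mul_of_one_le_left (norm_nonneg _) (le_max_left _ _)
    · exact mul_le_mul_of_nonneg_right (le_max_right _ _) (norm_nonneg _)
  have hRcl : IsClosed (T.range : Set H) := by
    have h1 : IsClosed (Set.range T) := hT.isClosed_range T.uniformContinuous
    have h2 : (T.range : Set H) = Set.range T := by ext; simp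
    exact h2 ▸ h1
  have hRtop : T.range = ⊤ := by
    have : CompleteSpace T.range := hRcl.completeSpace_coe
    rw [← Submodule.orthogonal_eq_bot_iff, Submodule.eq_bot_iff]
    intro z hz
    have hz' : ∀ x : ρ.domain, inner ℂ z ((x : H) + (ε : ℂ) • ρ x) = 0 := fun x =>
      (Submodule.mem_orthogonal' _ _).1 hz _ ⟨⟨_, LinearPMap.mem_graph ρ x⟩, rfl⟩
    have hεc : (ε : ℂ) ≠ 0 := by exact_mod_cast hε.ne'
    have hadj : ∀ x : ρ.domain, inner ℂ (-(ε : ℂ)⁻¹ • z) (x : H) = inner ℂ z (ρ x) := fun x => by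
      have e := hz' x
      rw [inner_add_right, inner_smul_right] at e
      rw [inner_smul_left, map_neg, map_inv₀, Complex.conj_ofReal]
      field_simp
      linear_combination -e
    have hdense := h.selfAdjoint.dense_domain
    have hdom := LinearPMap.mem_adjoint_domain_of_exists z ⟨_, hadj⟩
    have hval := LinearPMap.adjoint_apply_eq hdense ⟨z, hdom⟩ hadj
    have hg : (z, -(ε : ℂ)⁻¹ • z) ∈ ρ.graph := by
      have := LinearPMap.mem_graph ρ.adjoint ⟨z, hdom⟩
      rw [hval] at this
      exact (congrArg LinearPMap.graph (LinearPMap.isSelfAdjoint_def.1 h.selfAdjoint)) ▸ this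
    have hn := hfst _ hg
    rw [hL] at hn
    simp only [neg_smul, smul_neg, smul_inv_smul₀ hεc, add_neg_cancel, norm_zero] at hn
    exact norm_le_zero_iff.1 hn
  let e : ρ.graph ≃ₗ[ℂ] H :=
    LinearEquiv.ofBijective (T : ρ.graph →ₗ[ℂ] H) ⟨hT.injective, LinearMap.range_eq_top.1 hRtop⟩
  have he : ∀ p, e p = L p := fun p => rfl
  let a : H →L[ℂ] H := LinearMap.mkContinuous
    ((LinearMap.fst ℂ H H).comp (ρ.graph.subtype.comp e.symm.toLinearMap)) 1 fun ζ => by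
      have := hfst _ (e.symm ζ).2
      rw [← he, e.apply_symm_apply] at this
      simpa using this
  have ha : ∀ ζ, a ζ = (e.symm ζ : H × H).1 := fun ζ => rfl
  refine ⟨a, fun ζ ξ => ⟨?_, ?_⟩⟩
  · rintro rfl
    refine ⟨(e.symm ζ : H × H).2, (e.symm ζ).2, ?_⟩
    rw [ha, ← hL, ← he, e.apply_symm_apply]
  · rintro ⟨η, hη, rfl⟩
    have : e ⟨(ξ, η), hη⟩ = ξ + (ε : ℂ) • η := rfl
    rw [ha, ← this, e.symm_apply_apply]

/-- The bounded operator `(1 + ε ρ)⁻¹`. -/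
def resolventOp (ρ : H →ₗ.[ℂ] H) (ε : ℝ) : H →L[ℂ] H :=
  Classical.epsilon (IsResolvent ρ ε)

/-- The bounded operator `ρ_ε = ρ (1 + ε ρ)⁻¹ = ε⁻¹ (1 - (1 + ε ρ)⁻¹)`, which increases to `ρ`
as `ε` decreases to `0`. -/
def yosidaApprox (ρ : H →ₗ.[ℂ] H) (ε : ℝ) : H →L[ℂ] H :=
  ((ε⁻¹ : ℝ) : ℂ) • (1 - resolventOp ρ ε)

/-- The functional calculus `g(ρ)` of a positive self-adjoint operator `ρ`, for a continuous
function `g` with compact support. Since `ρ = a⁻¹ - 1` with `a = (1 + ρ)⁻¹`, it is the value at the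
bounded self-adjoint operator `a` of the continuous function that sends `t ≠ 0` to `g(t⁻¹ - 1)`
and `0` to `0`. -/
def funcCalc [CompleteSpace H] (ρ : H →ₗ.[ℂ] H) (g : ℝ → ℝ) : H →L[ℂ] H :=
  cfc (fun t : ℝ => if t = 0 then 0 else g (t⁻¹ - 1)) (resolventOp ρ 1)

end AffiliatedOperators

section Entropy

variable {H : Type*} [NormedAddCommGroup H] [InnerProductSpace ℂ H] [CompleteSpace H]

/-- `ρ` is the density of `φ` with respect to the trace `τ`: it is a positive non-singular
operator affiliated with `A` such that `φ(x) = τ(ρ x)` for all `x` in `A`, where, for the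
unbounded `ρ`, `τ(ρ x)` is the limit of `τ(ρ_ε x)` as `ε` decreases to `0`. -/
structure IsDensity (A : VonNeumannAlgebra H) (τ φ : A.toStarSubalgebra →ₗ[ℂ] ℂ)
    (ρ : H →ₗ.[ℂ] H) : Prop where
  positive : IsPositiveOperator ρ
  nonsingular : ∀ ξ : ρ.domain, ρ ξ = 0 → ξ = 0
  affiliated : IsAffiliated A ρ
  eq_trace : ∀ x : A.toStarSubalgebra,
    Tendsto (fun ε : ℝ => evalOp A τ (yosidaApprox ρ ε * (x : H →L[ℂ] H))) (𝓝[>] 0) (𝓝 (φ x))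

/-- `μ` is the spectral distribution of `ρ` with respect to `τ`: the probability measure `τ ∘ e`,
with `e` the spectral measure of `ρ`. It is determined by `τ(g(ρ)) = ∫ g dμ` for all continuous
`g` with compact support. -/
structure IsSpectralDistribution (A : VonNeumannAlgebra H) (τ : A.toStarSubalgebra →ₗ[ℂ] ℂ)
    (ρ : H →ₗ.[ℂ] H) (μ : Measure ℝ) : Prop where
  isProbability : IsProbabilityMeasure μ
  integral_eq : ∀ g : ℝ → ℝ, Continuous g → HasCompactSupport g →
    evalOp A τ (funcCalc ρ g) = ((∫ s, g s ∂μ : ℝ) : ℂ)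

/-- The density `ρ` of `φ` with respect to `τ`. -/
def density (A : VonNeumannAlgebra H) (τ φ : A.toStarSubalgebra →ₗ[ℂ] ℂ) : H →ₗ.[ℂ] H :=
  Classical.epsilon (IsDensity A τ φ)

/-- The spectral distribution of `ρ` with respect to `τ`. -/
def spectralDistribution (A : VonNeumannAlgebra H) (τ : A.toStarSubalgebra →ₗ[ℂ] ℂ)
    (ρ : H →ₗ.[ℂ] H) : Measure ℝ :=
  Classical.epsilon (IsSpectralDistribution A τ ρ)

/-- The integral `∫ f dμ = ∫ f⁺ dμ - ∫ f⁻ dμ` with values in `[-∞, ∞]`, for a function `f` at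
least one of whose parts `f⁺` and `f⁻` has a finite integral. -/
def extIntegral (μ : Measure ℝ) (f : ℝ → ℝ) : EReal :=
  ((∫⁻ s, ENNReal.ofReal (f s) ∂μ : ENNReal) : EReal) -
    ((∫⁻ s, ENNReal.ofReal (-f s) ∂μ : ENNReal) : EReal)

/-- The trace `τ(f(ρ)) = ∫ f(s) dτ(e_s) ∈ [-∞, ∞]`, where `ρ = ∫ s de_s` is the spectral
resolution of `ρ`. -/
def traceOf (A : VonNeumannAlgebra H) (τ : A.toStarSubalgebra →ₗ[ℂ] ℂ)
    (f : ℝ → ℝ) (ρ : H →ₗ.[ℂ] H) : EReal :=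
  extIntegral (spectralDistribution A τ ρ) f

/-- The entropy `S_τ(φ) = -τ(ρ log ρ)`, with `ρ` the density of `φ` with respect to `τ`. The
function `s log s` is bounded below on `[0, ∞)`, so that `τ(ρ log ρ)` lies in `(-∞, ∞]`. -/
def entropy (A : VonNeumannAlgebra H) (τ φ : A.toStarSubalgebra →ₗ[ℂ] ℂ) : EReal :=
  -traceOf A τ (fun s => s * Real.log s) (density A τ φ)

end Entropy

end

/-! The unbounded density is handled through the bounded operator a = (1 + ρ)⁻¹. With ψ = τ + φ,
formally ψ = τ((1 + ρ) ·), so ρ is a density exactly when ψ(ax) = τ(x) for all x;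
`IsDensityTransform` records this condition inside the algebra. Existence of a: since τ ≤ ψ, Sakai's
linear Radon-Nikodym theorem (`IsPositiveNormal.exists_linear_density`, by Hahn-Banach separation
and weak compactness) gives a positive contraction a with Re ψ(ax) = Re τ(x) for self-adjoint x. The
trace property puts a in the centralizer of ψ, which removes the real part
(`IsPositiveNormal.exists_tracial_density`). Faithfulness of τ makes a injective, so that ρ = a⁻¹ -
1 exists, and faithfulness of φ makes 1 - a injective, so that ρ is non-singular. Uniqueness of a
follows by testing the difference of two candidates on its own adjoint. Entropy: let ν be the
spectral measure of a in the state τ. It lives on [0, 1], has no atom at 0, and its image μ under t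
↦ t⁻¹ - 1 is the spectral distribution of ρ. Then φ(1) = 1 reads ∫ s dμ = 1, so that ∫ s log s dμ =
∫ (s log s + 1 - s) dμ whenever the left side is finite. The integrand on the right is nonnegative
on [0, ∞) and vanishes only at s = 1. Zero entropy thus forces a = 1/2, that is φ = τ. The value -∞
comes from diagonal operators on ℓ²: for weights w and p the density has eigenvalues pₙ/wₙ, and the
entropy is minus the relative entropy of p and w, which can be infinite. -/

noncomputable section

/-! ### Positive normal functionals and the functional calculus inside A. -/

section Functionals

variable {H : Type*} [NormedAddCommGroup H] [InnerProductSpace ℂ H] [CompleteSpace H]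

theorem VonNeumannAlgebra.isClosed (A : VonNeumannAlgebra H) :
    IsClosed (A.toStarSubalgebra : Set (H →L[ℂ] H)) := by
  rw [VonNeumannAlgebra.coe_toStarSubalgebra, ← A.centralizer_centralizer]
  exact Set.isClosed_centralizer _

theorem VonNeumannAlgebra.mem_of_commute {A : VonNeumannAlgebra H} {x : H →L[ℂ] H}
    (h : ∀ y ∈ A.commutant, ∀ ξ, y (x ξ) = x (y ξ)) : x ∈ A.toStarSubalgebra := by
  change x ∈ A
  rw [← A.commutant_commutant, VonNeumannAlgebra.mem_commutant_iff]
  exact fun y hy => ContinuousLinearMap.ext fun ξ => h y hy ξ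

theorem VonNeumannAlgebra.commutant_apply {A : VonNeumannAlgebra H} {x y : H →L[ℂ] H}
    (hx : x ∈ A.toStarSubalgebra) (hy : y ∈ A.commutant) (ξ : H) : y (x ξ) = x (y ξ) :=
  (DFunLike.congr_fun (VonNeumannAlgebra.mem_commutant_iff.1 hy x hx) ξ).symm

theorem VonNeumannAlgebra.cfc_mem {A : VonNeumannAlgebra H} {a : H →L[ℂ] H}
    (ha : a ∈ A.toStarSubalgebra) (f : ℝ → ℝ) : cfc f a ∈ A.toStarSubalgebra :=
  _root_.cfc_mem (hs := A.isClosed) f ha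

theorem VonNeumannAlgebra.cfcHom_mem {A : VonNeumannAlgebra H} {a : H →L[ℂ] H}
    (ha : a ∈ A.toStarSubalgebra) (hsa : IsSelfAdjoint a) (g : C(spectrum ℝ a, ℝ)) :
    cfcHom hsa g ∈ A.toStarSubalgebra := by
  obtain ⟨k, hk⟩ : cfcHom hsa g ∈ Set.range (cfc (R := ℝ) · a) := by
    rw [range_cfc_eq_range_cfcHom ℝ hsa]
    exact ⟨g, rfl⟩
  exact hk ▸ VonNeumannAlgebra.cfc_mem ha k

/-- A positive functional on a von Neumann algebra that is σ-weakly continuous. -/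
structure IsPositiveNormal (A : VonNeumannAlgebra H) (φ : A.toStarSubalgebra →ₗ[ℂ] ℂ) : Prop where
  nonneg : ∀ x, 0 ≤ (φ (star x * x)).re ∧ (φ (star x * x)).im = 0
  normal : @Continuous _ _ (sigmaWeakTopology A) _ φ

variable {A : VonNeumannAlgebra H} {τ φ ψ : A.toStarSubalgebra →ₗ[ℂ] ℂ}

theorem IsFaithfulNormalState.isPositiveNormal (h : IsFaithfulNormalState A φ) :
    IsPositiveNormal A φ := ⟨h.nonneg, h.normal⟩

theorem IsPositiveNormal.add (hτ : IsPositiveNormal A τ) (hφ : IsPositiveNormal A φ) :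
    IsPositiveNormal A (τ + φ) where
  nonneg x := by
    have h1 := hτ.nonneg x
    have h2 := hφ.nonneg x
    simp only [LinearMap.add_apply, Complex.add_re, Complex.add_im]
    exact ⟨add_nonneg h1.1 h2.1, by rw [h1.2, h2.2, add_zero]⟩
  normal := by
    let := sigmaWeakTopology A
    exact hτ.normal.add hφ.normal

namespace IsPositiveNormal

/-- A normal functional is continuous along bounded nets that converge weakly. -/
theorem tendsto (hφ : IsPositiveNormal A φ) {ι : Type*} {l : Filter ι}
    {u : ι → A.toStarSubalgebra} {a : A.toStarSubalgebra} {C : ℝ}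
    (hC : ∀ᶠ i in l, ‖(u i : H →L[ℂ] H)‖ ≤ C)
    (h : ∀ ξ η : H, Tendsto (fun i => inner ℂ ξ ((u i : H →L[ℂ] H) η)) l
      (𝓝 (inner ℂ ξ ((a : H →L[ℂ] H) η)))) :
    Tendsto (fun i => φ (u i)) l (𝓝 (φ a)) := by
  have hu : Tendsto u l (@nhds _ (sigmaWeakTopology A) a) := by
    simp only [nhds_iInf, tendsto_iInf, nhds_induced, tendsto_comap_iff]
    intro ξ η
    have hs : Summable fun n => ‖ξ n‖ * ‖η n‖ := by
      have h1 : Summable fun n => ‖ξ n‖ ^ (2 : ℝ) := by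
        simpa using (lp.memℓp ξ).summable (by norm_num)
      have h2 : Summable fun n => ‖η n‖ ^ (2 : ℝ) := by
        simpa using (lp.memℓp η).summable (by norm_num)
      exact Real.summable_mul_of_Lp_Lq_of_nonneg (p := 2) (q := 2)
        (by constructor <;> norm_num) (fun _ => norm_nonneg _) (fun _ => norm_nonneg _) h1 h2
    -- The norm bound on the net dominates the series termwise by C‖ξₙ‖‖ηₙ‖, which is summable by
    -- Hölder.
    refine tendsto_tsum_of_dominated_convergence (hs.mul_left C) (fun n => h _ _) ?_
    filter_upwards [hC] with i hi n
    calc ‖inner ℂ (ξ n) ((u i : H →L[ℂ] H) (η n))‖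
        ≤ ‖ξ n‖ * ‖(u i : H →L[ℂ] H) (η n)‖ := norm_inner_le_norm _ _
      _ ≤ ‖ξ n‖ * (C * ‖η n‖) := by
          gcongr
          exact (u i : H →L[ℂ] H).le_of_opNorm_le hi _
      _ = C * (‖ξ n‖ * ‖η n‖) := by ring
  exact (@Continuous.tendsto _ _ (sigmaWeakTopology A) _ _ hφ.normal a).comp hu

theorem continuous (hφ : IsPositiveNormal A φ) : Continuous φ := by
  rw [continuous_iff_continuousAt]
  intro a
  have hc : Continuous fun x : A.toStarSubalgebra => (x : H →L[ℂ] H) := continuous_subtype_val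
  refine hφ.tendsto (C := ‖(a : H →L[ℂ] H)‖ + 1) ?_ fun ξ η => ?_
  · exact (hc.norm.continuousAt (x := a)).eventually_le_const (by simp)
  · have : Continuous fun x : A.toStarSubalgebra => inner ℂ ξ ((x : H →L[ℂ] H) η) := by
      fun_prop
    exact this.tendsto a

theorem im_sq (hφ : IsPositiveNormal A φ) {x : A.toStarSubalgebra} (hx : IsSelfAdjoint x) :
    (φ (x * x)).im = 0 := by
  simpa [hx.star_eq] using (hφ.nonneg x).2

/-- Positivity controls only squares; 2x is recovered as (1 + x)² - 1 - x². -/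
theorem im_eq_zero (hφ : IsPositiveNormal A φ) {x : A.toStarSubalgebra} (hx : IsSelfAdjoint x) :
    (φ x).im = 0 := by
  have h1 := hφ.im_sq ((IsSelfAdjoint.one _).add hx)
  have h2 := hφ.im_sq hx
  have h3 := hφ.im_sq (IsSelfAdjoint.one A.toStarSubalgebra)
  have e : (1 + x) * (1 + x) = 1 * 1 + (x + x) + x * x := by noncomm_ring
  rw [e] at h1
  simp only [map_add, Complex.add_im, h2, h3] at h1
  linarith

theorem re_nonneg (hφ : IsPositiveNormal A φ) {x : A.toStarSubalgebra}
    (hx : 0 ≤ (x : H →L[ℂ] H)) : 0 ≤ (φ x).re := by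
  have hm := VonNeumannAlgebra.cfc_mem x.2 Real.sqrt
  set s : A.toStarSubalgebra := ⟨cfc Real.sqrt (x : H →L[ℂ] H), hm⟩
  have hs : star s * s = x := by
    apply Subtype.ext
    change star (cfc Real.sqrt (x : H →L[ℂ] H)) * cfc Real.sqrt (x : H →L[ℂ] H) = x
    have hsa : IsSelfAdjoint (cfc Real.sqrt (x : H →L[ℂ] H)) := cfc_predicate _ _
    have hxsa : IsSelfAdjoint (x : H →L[ℂ] H) := .of_nonneg hx
    rw [hsa.star_eq, ← cfc_mul _ _ _ (by fun_prop) (by fun_prop)]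
    conv_rhs => rw [← cfc_id' ℝ (x : H →L[ℂ] H)]
    refine cfc_congr fun t ht => Real.mul_self_sqrt (spectrum_nonneg_of_nonneg hx ht)
  rw [← hs]
  exact (hφ.nonneg s).1

theorem re_mono (hφ : IsPositiveNormal A φ) {x y : A.toStarSubalgebra}
    (hxy : (x : H →L[ℂ] H) ≤ y) : (φ x).re ≤ (φ y).re := by
  have := hφ.re_nonneg (x := y - x) (by simpa using hxy)
  simpa using this

/-- The element i(xy - yx) is self-adjoint, so its value is real, and the imaginary part of that
value is the difference of the two sides. -/
theorem re_mul_comm (hφ : IsPositiveNormal A φ) {x y : A.toStarSubalgebra}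
    (hx : IsSelfAdjoint x) (hy : IsSelfAdjoint y) : (φ (x * y)).re = (φ (y * x)).re := by
  have h : IsSelfAdjoint (Complex.I • (x * y - y * x)) := by
    rw [isSelfAdjoint_iff, star_smul, star_sub, star_mul, star_mul, hx.star_eq, hy.star_eq]
    simp only [RCLike.star_def, Complex.conj_I, neg_smul, ← smul_neg, neg_sub]
  have := hφ.im_eq_zero h
  simp only [map_smul, map_sub, smul_eq_mul, Complex.mul_im, Complex.I_re, Complex.I_im,
    Complex.sub_re] at this
  linarith

/-- The centralizer of a normal positive functional is stable under the functional calculus. -/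
theorem cfc_mul_comm (hφ : IsPositiveNormal A φ) {c : A.toStarSubalgebra}
    (hc : ∀ x, φ (c * x) = φ (x * c)) (f : ℝ → ℝ) (x : A.toStarSubalgebra) :
    φ (⟨cfc f (c : H →L[ℂ] H), VonNeumannAlgebra.cfc_mem c.2 f⟩ * x) =
      φ (x * ⟨cfc f (c : H →L[ℂ] H), VonNeumannAlgebra.cfc_mem c.2 f⟩) := by
  suffices ∃ h : cfc f (c : H →L[ℂ] H) ∈ A.toStarSubalgebra, ∀ x, φ (⟨_, h⟩ * x) = φ (x * ⟨_, h⟩)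
    from this.2 x
  refine cfc_cases (fun b : H →L[ℂ] H => ∃ h : b ∈ A.toStarSubalgebra,
    ∀ x, φ (⟨b, h⟩ * x) = φ (x * ⟨b, h⟩)) (c : H →L[ℂ] H) f ?_ fun hf ha => ?_
  · refine ⟨zero_mem _, fun x => ?_⟩
    have : (⟨0, zero_mem _⟩ : A.toStarSubalgebra) = 0 := rfl
    rw [this, zero_mul, mul_zero]
  have hmem := VonNeumannAlgebra.cfcHom_mem c.2 ha
  let F : C(spectrum ℝ (c : H →L[ℂ] H), ℝ) → A.toStarSubalgebra := fun g => ⟨cfcHom ha g, hmem g⟩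
  have hF : Continuous F := (cfcHom_continuous ha).subtype_mk _
  suffices ∀ g x, φ (F g * x) = φ (x * F g) from ⟨hmem _, this _⟩
  clear hf f x
  intro g
  -- Stone-Weierstrass: the functions whose value at c lies in the centralizer form a closed
  -- subalgebra containing the constants and the coordinate.
  induction g using ContinuousMap.induction_on_of_compact with
  | const r =>
    intro x
    have : F (ContinuousMap.const _ r) = algebraMap ℝ _ r := by
      apply Subtype.ext
      exact AlgHomClass.commutes (cfcHom ha) r
    rw [this, Algebra.commutes]
  | id =>
    have : F (.restrict (spectrum ℝ (c : H →L[ℂ] H)) (.id ℝ)) = c := Subtype.ext (cfcHom_id ha)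
    rwa [this]
  | star_id =>
    have : F (star (.restrict (spectrum ℝ (c : H →L[ℂ] H)) (.id ℝ))) = c :=
      Subtype.ext (by simp only [F, star_trivial]; exact cfcHom_id ha)
    rwa [this]
  | add f g hf hg =>
    intro x
    have : F (f + g) = F f + F g := Subtype.ext (map_add _ _ _)
    rw [this, add_mul, mul_add, map_add, map_add, hf, hg]
  | mul f g hf hg =>
    intro x
    have : F (f * g) = F f * F g := Subtype.ext (map_mul _ _ _)
    rw [this, mul_assoc, hf, mul_assoc, hg, mul_assoc]
  | frequently f hf =>
    intro x
    have hl : Continuous fun b : A.toStarSubalgebra => b * x :=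
      (continuous_subtype_val.mul continuous_const).subtype_mk _
    have hr : Continuous fun b : A.toStarSubalgebra => x * b :=
      (continuous_const.mul continuous_subtype_val).subtype_mk _
    have hcl : IsClosed {g | φ (F g * x) = φ (x * F g)} :=
      isClosed_eq (hφ.continuous.comp (hl.comp hF)) (hφ.continuous.comp (hr.comp hF))
    exact hcl.mem_of_frequently_of_tendsto (hf.mono fun g hg => hg x) tendsto_id

end IsPositiveNormal

end Functionals

end

noncomputable section

/-! ### Weak compactness of bounded sets of vectors and operators. -/

section WeakLimits

section Positivity

variable {H : Type*} [NormedAddCommGroup H] [InnerProductSpace ℂ H]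

open ComplexOrder in
theorem ContinuousLinearMap.nonneg_iff_inner {a : H →L[ℂ] H} :
    0 ≤ a ↔ ∀ ξ, 0 ≤ inner ℂ ξ (a ξ) := by
  rw [ContinuousLinearMap.nonneg_iff_isPositive]
  refine ⟨fun h => h.inner_nonneg_right, fun h => ?_⟩
  rw [ContinuousLinearMap.isPositive_iff_complex]
  intro ξ
  have h1 := h ξ
  rw [← inner_conj_symm, Complex.nonneg_iff, Complex.conj_re, Complex.conj_im] at h1
  exact ⟨Complex.ext rfl (by simpa [eq_comm] using h1.2), h1.1⟩

open ComplexOrder in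
theorem nonneg_of_weak_limit {ι : Type*} {l : Filter ι} [l.NeBot] {u : ι → H →L[ℂ] H}
    {a : H →L[ℂ] H} (hu : ∀ i, 0 ≤ u i)
    (h : ∀ ξ η, Tendsto (fun i => inner ℂ ξ (u i η)) l (𝓝 (inner ℂ ξ (a η)))) : 0 ≤ a := by
  rw [ContinuousLinearMap.nonneg_iff_inner]
  exact fun ξ => ge_of_tendsto' (h ξ ξ) fun i => ContinuousLinearMap.nonneg_iff_inner.1 (hu i) ξ

end Positivity

variable {H : Type*} [NormedAddCommGroup H] [InnerProductSpace ℂ H] [CompleteSpace H]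
-- Banach-Alaoglu, transported by the Riesz isomorphism. The complex conjugates in the proof appear
-- because the vector sits in the linear slot of the inner product here.
theorem exists_weak_limit_vector {ι : Type*} (l : Ultrafilter ι) {v : ι → H} {C : ℝ}
    (hC : ∀ i, ‖v i‖ ≤ C) :
    ∃ w, ‖w‖ ≤ C ∧ ∀ ξ, Tendsto (fun i => inner ℂ ξ (v i)) l (𝓝 (inner ℂ ξ w)) := by
  have hc := WeakDual.isCompact_closedBall (𝕜 := ℂ) (E := H) 0 C
  let F : ι → WeakDual ℂ H := fun i => StrongDual.toWeakDual (InnerProductSpace.toDual ℂ H (v i))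
  obtain ⟨f, hf, hlim⟩ := hc.ultrafilter_le_nhds (l.map F) (by
    rw [le_principal_iff]
    refine Filter.mem_map.2 (Eventually.of_forall fun i => ?_)
    simpa [F] using hC i)
  refine ⟨(InnerProductSpace.toDual ℂ H).symm (WeakDual.toStrongDual f), ?_, fun ξ => ?_⟩
  · simpa using hf
  · have h1 : Tendsto (fun i => F i ξ) l (𝓝 (f ξ)) :=
      ((WeakDual.eval_continuous ξ).tendsto f).comp hlim
    have h2 := (Complex.continuous_conj.tendsto _).comp h1
    have e : ∀ w : H, inner ℂ ξ w = (starRingEnd ℂ) (inner ℂ w ξ) := fun w =>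
      (inner_conj_symm _ _).symm
    simp only [e, InnerProductSpace.toDual_symm_apply]
    exact h2

/-- Weak limits are taken vector by vector along one fixed ultrafilter; uniqueness of limits then
makes the result linear. -/
theorem exists_weak_limit {ι : Type*} (l : Ultrafilter ι) {u : ι → H →L[ℂ] H} {C : ℝ}
    (hC : ∀ i, ‖u i‖ ≤ C) :
    ∃ a : H →L[ℂ] H, ∀ ξ η, Tendsto (fun i => inner ℂ ξ (u i η)) l (𝓝 (inner ℂ ξ (a η))) := by
  choose a ha hlim using fun η => exists_weak_limit_vector l (v := fun i => u i η)
    (C := C * ‖η‖) fun i => (u i).le_of_opNorm_le (hC i) η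
  refine ⟨LinearMap.mkContinuous ⟨⟨a, fun x y => ?_⟩, fun c x => ?_⟩ C ha, fun ξ η => hlim η ξ⟩
  · refine ext_inner_left ℂ fun ξ => tendsto_nhds_unique (hlim _ ξ) ?_
    simpa only [map_add, inner_add_right] using (hlim x ξ).add (hlim y ξ)
  · refine ext_inner_left ℂ fun ξ => tendsto_nhds_unique (hlim _ ξ) ?_
    simpa only [map_smul, inner_smul_right] using! (hlim x ξ).const_mul c

end WeakLimits

/-! ### Sakai's linear Radon-Nikodym theorem and its tracial form. -/

section LinearRadonNikodym

/-- Separation of a point from a closed convex set in a weak topology. -/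
theorem WeakBilin.exists_separating {E F : Type*} [AddCommGroup E] [Module ℝ E] [AddCommGroup F]
    [Module ℝ F] (B : E →ₗ[ℝ] F →ₗ[ℝ] ℝ) {S : Set (WeakBilin B)} (hS : Convex ℝ S)
    (hcl : IsClosed S) {g : WeakBilin B} (hg : g ∉ S) :
    ∃ (x : F) (u : ℝ), (∀ f ∈ S, B f x < u) ∧ u < B g x := by
  obtain ⟨f, u, hfS, hfT⟩ := geometric_hahn_banach_closed_point hS hcl hg
  obtain ⟨x, rfl⟩ := LinearMap.dualEmbedding_surjective B f
  exact ⟨x, u, hfS, hfT⟩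

variable {H : Type*} [NormedAddCommGroup H] [InnerProductSpace ℂ H] [CompleteSpace H]
variable {A : VonNeumannAlgebra H} {τ φ ψ : A.toStarSubalgebra →ₗ[ℂ] ℂ}

/-- The positive part of a self-adjoint element is almost attained by contractions. -/
theorem IsPositiveNormal.exists_contraction_mul (hψ : IsPositiveNormal A ψ)
    (hτ : IsPositiveNormal A τ)
    (hle : ∀ x : A.toStarSubalgebra, 0 ≤ (x : H →L[ℂ] H) → (τ x).re ≤ (ψ x).re)
    {x : A.toStarSubalgebra} (hx : IsSelfAdjoint x) {δ : ℝ} (hδ : 0 < δ) :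
    ∃ a : A.toStarSubalgebra, 0 ≤ (a : H →L[ℂ] H) ∧ (a : H →L[ℂ] H) ≤ 1 ∧
      (τ x).re ≤ (ψ (a * x)).re + δ * (ψ 1).re := by
  have hx' : IsSelfAdjoint (x : H →L[ℂ] H) := congrArg Subtype.val hx
  -- With t⁺ = max t 0, the function f(t) = t⁺/(t⁺ + δ) is a continuous substitute for the indicator
  -- of t > 0: it satisfies 0 ≤ f ≤ 1 and f(t)t + δ ≥ t⁺.
  have hf : Continuous fun t : ℝ => max t 0 / (max t 0 + δ) := by
    refine Continuous.div (by fun_prop) (by fun_prop) fun t => ?_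
    have := le_max_right t 0
    positivity
  let p : A.toStarSubalgebra :=
    ⟨cfc (fun t : ℝ => max t 0) (x : H →L[ℂ] H), VonNeumannAlgebra.cfc_mem x.2 _⟩
  let a : A.toStarSubalgebra :=
    ⟨cfc (fun t : ℝ => max t 0 / (max t 0 + δ)) (x : H →L[ℂ] H), VonNeumannAlgebra.cfc_mem x.2 _⟩
  have hp : 0 ≤ (p : H →L[ℂ] H) := cfc_nonneg fun t _ => le_max_right _ _
  have hxp : (x : H →L[ℂ] H) ≤ p := by
    change (x : H →L[ℂ] H) ≤ cfc (fun t : ℝ => max t 0) (x : H →L[ℂ] H)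
    conv_lhs => rw [← cfc_id' ℝ (x : H →L[ℂ] H)]
    exact cfc_mono (fun t _ => le_max_left t 0) (by fun_prop) (by fun_prop)
  have hax : ((a * x : A.toStarSubalgebra) : H →L[ℂ] H) =
      cfc (fun t : ℝ => max t 0 / (max t 0 + δ) * t) (x : H →L[ℂ] H) := by
    rw [cfc_mul _ _ _ hf.continuousOn (by fun_prop), cfc_id' ℝ (x : H →L[ℂ] H)]
    rfl
  have hpa : (p : H →L[ℂ] H) ≤ (a * x + (δ : ℂ) • 1 : A.toStarSubalgebra) := by
    have : ((a * x + (δ : ℂ) • 1 : A.toStarSubalgebra) : H →L[ℂ] H) =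
        cfc (fun t : ℝ => max t 0 / (max t 0 + δ) * t + δ) (x : H →L[ℂ] H) := by
      rw [cfc_add_const δ _ _ (by fun_prop), ← hax]
      simp [Algebra.algebraMap_eq_smul_one]
    rw [this]
    refine cfc_mono (fun t _ => ?_) (by fun_prop) (by fun_prop)
    rcases le_total t 0 with ht | ht
    · simp [ht, hδ.le]
    · rw [max_eq_left ht, div_mul_eq_mul_div, ← sub_le_iff_le_add, le_div_iff₀ (by positivity)]
      nlinarith
  refine ⟨a, cfc_nonneg fun t _ => ?_, cfc_le_one _ _ fun t _ => ?_, ?_⟩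
  · have := le_max_right t 0
    positivity
  · have := le_max_right t 0
    rw [div_le_one (by positivity)]
    linarith
  · calc (τ x).re ≤ (τ p).re := hτ.re_mono hxp
      _ ≤ (ψ p).re := hle p hp
      _ ≤ (ψ (a * x + (δ : ℂ) • 1)).re := hψ.re_mono hpa
      _ = _ := by simp

/-- The positive contractions of a von Neumann algebra are compact for the convergence of all
functionals `ψ(· x)`, with `ψ` normal. -/
theorem exists_contraction_limit {ι : Type*} (l : Ultrafilter ι) {s : ι → A.toStarSubalgebra}
    (hs0 : ∀ i, 0 ≤ (s i : H →L[ℂ] H)) (hs1 : ∀ i, (s i : H →L[ℂ] H) ≤ 1) :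
    ∃ a : A.toStarSubalgebra, 0 ≤ (a : H →L[ℂ] H) ∧ (a : H →L[ℂ] H) ≤ 1 ∧
      ∀ ψ : A.toStarSubalgebra →ₗ[ℂ] ℂ, IsPositiveNormal A ψ →
        ∀ x, Tendsto (fun i => ψ (s i * x)) l (𝓝 (ψ (a * x))) := by
  have hn : ∀ i, ‖(s i : H →L[ℂ] H)‖ ≤ 1 := fun i =>
    (CStarAlgebra.norm_le_one_iff_of_nonneg _ (hs0 i)).2 (hs1 i)
  obtain ⟨a, ha⟩ := exists_weak_limit l hn
  have haA : a ∈ A.toStarSubalgebra := by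
    refine VonNeumannAlgebra.mem_of_commute fun y hy ξ => ext_inner_left ℂ fun ζ => ?_
    refine tendsto_nhds_unique ?_ (ha ζ (y ξ))
    have := ha (star y ζ) ξ
    simp only [ContinuousLinearMap.star_eq_adjoint, ContinuousLinearMap.adjoint_inner_left] at this
    simpa only [VonNeumannAlgebra.commutant_apply (s _).2 hy] using this
  have ha1 : a ≤ 1 := by
    rw [← sub_nonneg]
    refine nonneg_of_weak_limit (l := (l : Filter ι))
      (u := fun i => 1 - (s i : H →L[ℂ] H)) (fun i => sub_nonneg.2 (hs1 i)) fun ξ η => ?_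
    simpa [inner_sub_right] using (ha ξ η).const_sub (inner ℂ ξ η)
  refine ⟨⟨a, haA⟩, nonneg_of_weak_limit hs0 ha, ha1, fun ψ hψ x => ?_⟩
  refine hψ.tendsto (C := 1 * ‖(x : H →L[ℂ] H)‖)
    (Eventually.of_forall fun i => ?_) fun ξ η => ha ξ _
  exact (norm_mul_le _ _).trans (mul_le_mul_of_nonneg_right (hn i) (norm_nonneg _))

/-- The bilinear pairing `(a, x) ↦ Re ψ(a x)` with self-adjoint elements. -/
def rePairing (ψ : A.toStarSubalgebra →ₗ[ℂ] ℂ) :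
    A.toStarSubalgebra →ₗ[ℝ] Module.Dual ℝ (selfAdjoint A.toStarSubalgebra) :=
  LinearMap.mk₂ ℝ (fun a x => (ψ (a * (x : A.toStarSubalgebra))).re)
    (fun a b x => by simp [add_mul])
    (fun r a x => by rw [smul_mul_assoc, LinearMap.map_smul_of_tower, Complex.smul_re])
    (fun a x y => by simp [mul_add])
    (fun r a x => by
      rw [selfAdjoint.val_smul, mul_smul_comm, LinearMap.map_smul_of_tower, Complex.smul_re])

/-- Sakai's linear Radon-Nikodym theorem. -/
theorem IsPositiveNormal.exists_linear_density (hψ : IsPositiveNormal A ψ)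
    (hτ : IsPositiveNormal A τ)
    (hle : ∀ x : A.toStarSubalgebra, 0 ≤ (x : H →L[ℂ] H) → (τ x).re ≤ (ψ x).re) :
    ∃ a : A.toStarSubalgebra, 0 ≤ (a : H →L[ℂ] H) ∧ (a : H →L[ℂ] H) ≤ 1 ∧
      ∀ x, IsSelfAdjoint x → (ψ (a * x)).re = (τ x).re := by
  let B : Module.Dual ℝ (selfAdjoint A.toStarSubalgebra) →ₗ[ℝ]
    selfAdjoint A.toStarSubalgebra →ₗ[ℝ] ℝ := LinearMap.id
  let K : Set A.toStarSubalgebra := {a | 0 ≤ (a : H →L[ℂ] H) ∧ (a : H →L[ℂ] H) ≤ 1}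
  let Φ : A.toStarSubalgebra →ₗ[ℝ] WeakBilin B := rePairing ψ
  let S : Set (WeakBilin B) := Φ '' K
  have hK0 : (0 : A.toStarSubalgebra) ∈ K := ⟨le_rfl, zero_le_one⟩
  have hK : Convex ℝ K := by
    have := (convex_Icc (𝕜 := ℝ) (0 : H →L[ℂ] H) 1).linear_preimage
      (A.toStarSubalgebra.toSubalgebra.val.toLinearMap.restrictScalars ℝ)
    exact this
  have hS : Convex ℝ S := hK.linear_image Φ
  -- The image of the weakly compact set K is closed: an ultrafilter on S is lifted to K by a choice
  -- of preimages, and the limit found there maps to the given limit.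
  have hcl : IsClosed S := by
    rw [← closure_subset_iff_isClosed]
    intro g hg
    obtain ⟨l, hlS, hlg⟩ := mem_closure_iff_ultrafilter.1 hg
    have hsec : ∀ f : WeakBilin B, ∃ a ∈ K, f ∈ S → Φ a = f := fun f => by
      by_cases hf : f ∈ S
      · obtain ⟨a, ha, rfl⟩ := hf
        exact ⟨a, ha, fun _ => rfl⟩
      · exact ⟨0, hK0, fun h => absurd h hf⟩
    choose s hsK hs using hsec
    obtain ⟨a, ha0, ha1, ha⟩ :=
      exists_contraction_limit l (fun i => (hsK i).1) (fun i => (hsK i).2)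
    refine ⟨a, ⟨ha0, ha1⟩, ?_⟩
    refine LinearMap.ext fun x => ?_
    have h1 := ha ψ hψ x
    have h2 : Tendsto (fun i : WeakBilin B => B i x) l (𝓝 (B g x)) :=
      ((WeakBilin.eval_continuous B x).tendsto g).mono_left hlg
    refine tendsto_nhds_unique ((Complex.continuous_re.tendsto _).comp h1) (h2.congr' ?_)
    filter_upwards [hlS] with i hi
    exact (congrArg (fun j => B j x) (hs i hi)).symm
  let T : WeakBilin B := rePairing τ 1
  have hT : ∀ x : selfAdjoint A.toStarSubalgebra, B T x = (τ x).re := fun x => by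
    change (τ (1 * (x : A.toStarSubalgebra))).re = _
    rw [one_mul]
  by_cases hTS : T ∈ S
  · obtain ⟨a, ha, haT⟩ := hTS
    exact ⟨a, ha.1, ha.2, fun x hx => (congrArg (fun j => B j ⟨x, hx⟩) haT).trans (hT ⟨x, hx⟩)⟩
  · obtain ⟨x, u, hfS, hfT⟩ := WeakBilin.exists_separating B hS hcl hTS
    have hfT' : u < (τ x).re := (hT x) ▸ hfT
    have h1 : 0 ≤ (ψ 1).re := hψ.re_nonneg (x := 1) zero_le_one
    -- This δ satisfies δ ψ(1) ≤ τ(x) - u, so the almost optimal contraction contradicts the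
    -- separation; the added 1 covers ψ(1) = 0.
    have hδ : 0 < ((τ x).re - u) / ((ψ 1).re + 1) := div_pos (by linarith) (by linarith)
    obtain ⟨a, ha0, ha1, ha⟩ := hψ.exists_contraction_mul hτ hle x.2 hδ
    have h2 : (ψ (a * x)).re < u := hfS _ ⟨a, ⟨ha0, ha1⟩, rfl⟩
    have h3 : ((τ x).re - u) / ((ψ 1).re + 1) * (ψ 1).re ≤ (τ x).re - u := by
      rw [div_mul_eq_mul_div, div_le_iff₀ (by linarith)]
      exact mul_le_mul_of_nonneg_left (by linarith) (by linarith)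
    linarith

/-- A tracial functional dominated by `ψ` is `ψ(a ·)` for a positive contraction `a` in the
centralizer of `ψ`. -/
theorem IsPositiveNormal.exists_tracial_density (hψ : IsPositiveNormal A ψ)
    (hτ : IsPositiveNormal A τ) (htr : IsTracial A τ)
    (hle : ∀ x : A.toStarSubalgebra, 0 ≤ (x : H →L[ℂ] H) → (τ x).re ≤ (ψ x).re) :
    ∃ a : A.toStarSubalgebra, 0 ≤ (a : H →L[ℂ] H) ∧ (a : H →L[ℂ] H) ≤ 1 ∧
      ∀ x, ψ (a * x) = τ x := by
  obtain ⟨a, ha0, ha1, ha⟩ := hψ.exists_linear_density hτ hle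
  have hasa : IsSelfAdjoint a := Subtype.ext (IsSelfAdjoint.of_nonneg ha0)
  have hsa : ∀ x, IsSelfAdjoint x → ψ (a * x + x * a) = 2 * τ x := by
    intro x hx
    have hs : IsSelfAdjoint (a * x + x * a) := by
      rw [isSelfAdjoint_iff, star_add, star_mul, star_mul, hasa.star_eq, hx.star_eq, add_comm]
    apply Complex.ext
    · have := hψ.re_mul_comm hx hasa
      simp only [map_add, Complex.add_re, Complex.mul_re, Complex.re_ofNat, Complex.im_ofNat,
        zero_mul, sub_zero, this, ha x hx]
      ring
    · rw [hψ.im_eq_zero hs]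
      simp [hτ.im_eq_zero hx]
  have hall : ∀ x, ψ (a * x + x * a) = 2 * τ x := by
    intro x
    rw [← realPart_add_I_smul_imaginaryPart x]
    have e1 := hsa _ (realPart x).2
    have e2 := hsa _ (imaginaryPart x).2
    simp only [mul_add, add_mul, mul_smul_comm, smul_mul_assoc, map_add, map_smul,
      smul_eq_mul] at e1 e2 ⊢
    linear_combination e1 + Complex.I * e2
  -- Inserting ax and xa into `hall` gives ψ(a²x + axa) = 2τ(ax) = 2τ(xa) = ψ(axa + xa²), and the
  -- middle terms cancel.
  have hsq : ∀ x, ψ (a * a * x) = ψ (x * (a * a)) := by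
    intro x
    have e1 := hall (a * x)
    have e2 := hall (x * a)
    rw [htr a x] at e1
    have e3 := e1.trans e2.symm
    simp only [map_add, mul_assoc] at e3 ⊢
    linear_combination e3
  -- As a ≥ 0, it is the square root of a², and the centralizer is stable under the functional
  -- calculus.
  have hcomm : ∀ x, ψ (a * x) = ψ (x * a) := by
    intro x
    have := hψ.cfc_mul_comm hsq Real.sqrt x
    have e : (⟨cfc Real.sqrt ((a * a : A.toStarSubalgebra) : H →L[ℂ] H),
        VonNeumannAlgebra.cfc_mem (a * a).2 _⟩ : A.toStarSubalgebra) = a := by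
      apply Subtype.ext
      have hsa' : IsSelfAdjoint (a : H →L[ℂ] H) := .of_nonneg ha0
      have e1 : ((a * a : A.toStarSubalgebra) : H →L[ℂ] H) =
          cfc (fun t : ℝ => t * t) (a : H →L[ℂ] H) := by
        rw [cfc_mul _ _ _ (by fun_prop) (by fun_prop), cfc_id' ℝ (a : H →L[ℂ] H)]
        rfl
      change cfc Real.sqrt ((a * a : A.toStarSubalgebra) : H →L[ℂ] H) = a
      rw [e1, ← cfc_comp' Real.sqrt (fun t : ℝ => t * t) _ (by fun_prop) (by fun_prop)]
      conv_rhs => rw [← cfc_id' ℝ (a : H →L[ℂ] H)]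
      exact cfc_congr fun t ht => Real.sqrt_mul_self (spectrum_nonneg_of_nonneg ha0 ht)
    rwa [e] at this
  refine ⟨a, ha0, ha1, fun x => ?_⟩
  have := hall x
  rw [map_add, ← hcomm] at this
  linear_combination this / 2

end LinearRadonNikodym

end

noncomputable section

/-! ### The correspondence between ρ and (1 + ρ)⁻¹. -/

section BoundedTransform

variable {H : Type*} [NormedAddCommGroup H] [InnerProductSpace ℂ H]

/-- This turns questions about the unbounded ρ into equations for the bounded a; in particular a
determines ρ. -/
theorem IsResolvent.mem_graph_iff {ρ : H →ₗ.[ℂ] H} {a : H →L[ℂ] H} (h : IsResolvent ρ 1 a)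
    (ξ η : H) : (ξ, η) ∈ ρ.graph ↔ a (ξ + η) = ξ := by
  rw [h]
  constructor
  · exact fun hg => ⟨η, hg, by simp⟩
  · rintro ⟨η', hg, he⟩
    rw [Complex.ofReal_one, one_smul, add_right_inj] at he
    rwa [he]

theorem IsResolvent.resolventOp_eq {ρ : H →ₗ.[ℂ] H} {ε : ℝ} {a : H →L[ℂ] H}
    (h : IsResolvent ρ ε a) : resolventOp ρ ε = a :=
  (Classical.epsilon_spec (p := IsResolvent ρ ε) ⟨a, h⟩).unique h

theorem IsPositiveOperator.isResolvent_resolventOp [CompleteSpace H] {ρ : H →ₗ.[ℂ] H}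
    (h : IsPositiveOperator ρ) {ε : ℝ} (hε : 0 < ε) : IsResolvent ρ ε (resolventOp ρ ε) :=
  Classical.epsilon_spec (h.exists_resolvent hε)

theorem IsResolvent.injective {ρ : H →ₗ.[ℂ] H} {a : H →L[ℂ] H} (h : IsResolvent ρ 1 a) :
    Function.Injective a := by
  rw [injective_iff_map_eq_zero]
  intro ζ hζ
  have : ((0 : H), ζ) ∈ ρ.graph := by rw [h.mem_graph_iff, zero_add, hζ]
  exact LinearPMap.graph_fst_eq_zero_snd ρ this rfl

theorem eq_of_isResolvent {ρ σ : H →ₗ.[ℂ] H} {a : H →L[ℂ] H} (hρ : IsResolvent ρ 1 a)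
    (hσ : IsResolvent σ 1 a) : ρ = σ := by
  refine LinearPMap.eq_of_eq_graph (Submodule.ext fun ⟨ξ, η⟩ => ?_)
  rw [hρ.mem_graph_iff, hσ.mem_graph_iff]

variable [CompleteSpace H]

theorem IsPositiveOperator.inner_nonneg_of_mem_graph {ρ : H →ₗ.[ℂ] H} (h : IsPositiveOperator ρ)
    {ξ η : H} (hg : (ξ, η) ∈ ρ.graph) :
    0 ≤ (inner ℂ ξ η).re ∧ (inner ℂ ξ η).im = 0 := by
  obtain ⟨x, hx, hy⟩ := (LinearPMap.mem_graph_iff _).1 hg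
  simp only at hx hy
  subst hx hy
  refine ⟨h.nonneg x, ?_⟩
  have hf := LinearPMap.adjoint_isFormalAdjoint h.selfAdjoint.dense_domain
  rw [LinearPMap.isSelfAdjoint_def.1 h.selfAdjoint] at hf
  have e := hf x x
  rw [← inner_conj_symm] at e
  exact Complex.conj_eq_iff_im.1 e

/-- Writing ζ = ξ + ρξ with ξ = aζ gives ⟨ζ, aζ⟩ = ‖ξ‖² + ⟨ρξ, ξ⟩. The upper bound below uses ⟨ζ, (1
- a)ζ⟩ = ⟨ξ, ρξ⟩ + ‖ρξ‖² in the same way. -/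
theorem IsPositiveOperator.resolvent_nonneg {ρ : H →ₗ.[ℂ] H} (h : IsPositiveOperator ρ)
    {a : H →L[ℂ] H} (ha : IsResolvent ρ 1 a) : 0 ≤ a := by
  rw [ContinuousLinearMap.nonneg_iff_inner]
  intro ζ
  obtain ⟨η, hg, he⟩ := (ha ζ (a ζ)).1 rfl
  obtain ⟨h1, h2⟩ := h.inner_nonneg_of_mem_graph hg
  nth_rewrite 1 [he]
  rw [Complex.ofReal_one, one_smul, inner_add_left, inner_self_eq_norm_sq_to_K, ← inner_conj_symm,
    Complex.nonneg_iff]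
  simp only [Complex.coe_algebraMap, ← Complex.ofReal_pow, Complex.add_re, Complex.ofReal_re,
    Complex.conj_re, Complex.add_im, Complex.ofReal_im, Complex.conj_im, h2]
  exact ⟨by positivity, by simp⟩

theorem IsPositiveOperator.resolvent_le_one {ρ : H →ₗ.[ℂ] H} (h : IsPositiveOperator ρ)
    {a : H →L[ℂ] H} (ha : IsResolvent ρ 1 a) : a ≤ 1 := by
  rw [← sub_nonneg, ContinuousLinearMap.nonneg_iff_inner]
  intro ζ
  obtain ⟨η, hg, he⟩ := (ha ζ (a ζ)).1 rfl
  obtain ⟨h1, h2⟩ := h.inner_nonneg_of_mem_graph hg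
  rw [Complex.ofReal_one, one_smul] at he
  have e : (1 - a) ζ = η := by
    rw [sub_apply, one_apply_eq_self, sub_eq_iff_eq_add', ← he]
  rw [e]
  nth_rewrite 1 [he]
  rw [inner_add_left, inner_self_eq_norm_sq_to_K, Complex.nonneg_iff]
  simp only [Complex.coe_algebraMap, ← Complex.ofReal_pow, Complex.add_re, Complex.ofReal_re,
    Complex.add_im, Complex.ofReal_im, h2]
  exact ⟨by positivity, by simp⟩

theorem IsAffiliated.resolvent_mem {A : VonNeumannAlgebra H} {ρ : H →ₗ.[ℂ] H}
    (h : IsAffiliated A ρ) {a : H →L[ℂ] H} (ha : IsResolvent ρ 1 a) :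
    a ∈ A.toStarSubalgebra := by
  refine VonNeumannAlgebra.mem_of_commute fun y hy ζ => ?_
  have := h y hy (a ζ) (ζ - a ζ) (by rw [ha.mem_graph_iff]; congr 1; abel)
  rw [ha.mem_graph_iff, map_sub, add_sub_cancel] at this
  exact this.symm

theorem IsResolvent.isAffiliated {A : VonNeumannAlgebra H} {ρ : H →ₗ.[ℂ] H}
    {a : H →L[ℂ] H} (ha : IsResolvent ρ 1 a) (h : a ∈ A.toStarSubalgebra) :
    IsAffiliated A ρ := by
  intro y hy ξ η hg
  rw [ha.mem_graph_iff] at hg ⊢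
  rw [← map_add, ← VonNeumannAlgebra.commutant_apply h hy, hg]

theorem spectrum_subset_Icc {a : H →L[ℂ] H} (h0 : 0 ≤ a) (h1 : a ≤ 1) {t : ℝ}
    (ht : t ∈ spectrum ℝ a) : t ∈ Set.Icc 0 1 := by
  refine ⟨spectrum_nonneg_of_nonneg h0 ht, ?_⟩
  exact (le_algebraMap_iff_spectrum_le (r := (1 : ℝ)) (.of_nonneg h0)).1 (by simpa using h1) t ht

theorem denseRange_of_injective {a : H →L[ℂ] H} (ha : IsSelfAdjoint a)
    (hinj : Function.Injective a) : DenseRange a := by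
  have h1 : a.rangeᗮ = ⊥ := by
    rw [ContinuousLinearMap.orthogonal_range, ← ContinuousLinearMap.star_eq_adjoint, ha.star_eq]
    exact LinearMap.ker_eq_bot.2 hinj
  have h2 := (Submodule.dense_iff_topologicalClosure_eq_top (s := a.range)).2
    ((Submodule.topologicalClosure_eq_top_iff).2 h1)
  have h3 : (a.range : Set H) = Set.range a := by ext; simp
  rwa [h3] at h2

/-- Every injective positive contraction is `(1 + ρ)⁻¹` for a positive self-adjoint `ρ`. -/
theorem exists_isPositiveOperator {a : H →L[ℂ] H} (h0 : 0 ≤ a) (h1 : a ≤ 1)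
    (hinj : Function.Injective a) :
    ∃ ρ : H →ₗ.[ℂ] H, IsPositiveOperator ρ ∧ IsResolvent ρ 1 a := by
  have hsa : IsSelfAdjoint a := .of_nonneg h0
  have hsym : ∀ x y, inner ℂ (a x) y = inner ℂ x (a y) :=
    ContinuousLinearMap.isSelfAdjoint_iff_isSymmetric.1 hsa
  -- The graph of a⁻¹ - 1, parametrised by ζ ↦ (aζ, ζ - aζ). Injectivity of a makes it single-valued
  -- and, a being self-adjoint, its domain dense.
  let g : Submodule ℂ (H × H) := (a.prod (1 - a)).range
  have hg : ∀ ξ η, (ξ, η) ∈ g ↔ a (ξ + η) = ξ := by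
    intro ξ η
    constructor
    · rintro ⟨ζ, hζ⟩
      obtain ⟨rfl, rfl⟩ := Prod.ext_iff.1 hζ
      simp
    · intro h
      refine ⟨ξ + η, ?_⟩
      simp [h]
  have hgr : g.toLinearPMap.graph = g := by
    refine Submodule.toLinearPMap_graph_eq _ fun x hx hx1 => ?_
    have := (hg x.1 x.2).1 hx
    rw [hx1, zero_add] at this
    exact hinj (this.trans (map_zero a).symm)
  have hdense : Dense (g.toLinearPMap.domain : Set H) := by
    refine (denseRange_of_injective hsa hinj).mono ?_
    rintro _ ⟨ζ, rfl⟩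
    refine LinearPMap.mem_domain_of_mem_graph (y := ζ - a ζ) ?_
    rw [hgr, hg]
    simp
  have hself : IsSelfAdjoint g.toLinearPMap := by
    rw [LinearPMap.isSelfAdjoint_def]
    refine LinearPMap.eq_of_eq_graph ?_
    rw [LinearPMap.adjoint_graph_eq_graph_adjoint hdense, hgr]
    ext ⟨ξ, η⟩
    rw [Submodule.mem_adjoint_iff, hg]
    constructor
    · intro h
      refine ext_inner_left ℂ fun ζ => ?_
      have := h (a ζ) (ζ - a ζ) ((hg _ _).2 (by simp))
      rw [inner_sub_left, sub_sub, sub_eq_zero, hsym, hsym, ← inner_add_right, ← map_add] at this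
      exact this.symm
    · intro h b c hbc
      rw [hg] at hbc
      have e : inner ℂ (b + c) ξ = inner ℂ b (ξ + η) := by
        nth_rewrite 1 [← h]
        rw [← hsym, hbc]
      rw [inner_add_left, inner_add_right] at e
      linear_combination e
  refine ⟨g.toLinearPMap, ⟨hself, fun x => ?_⟩, fun ζ ξ => ?_⟩
  · have hx := LinearPMap.mem_graph g.toLinearPMap x
    rw [hgr] at hx
    obtain ⟨ζ, hζ⟩ := hx
    obtain ⟨e1, e2⟩ := Prod.ext_iff.1 hζ
    simp only at e1 e2
    rw [← e1, ← e2]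
    change 0 ≤ (inner ℂ (a ζ) ((1 - a) ζ)).re
    rw [hsym]
    have hpos : 0 ≤ a * (1 - a) :=
      Commute.mul_nonneg h0 (sub_nonneg.2 h1) ((Commute.one_right a).sub_right (Commute.refl a))
    exact (Complex.nonneg_iff.1 (ContinuousLinearMap.nonneg_iff_inner.1 hpos ζ)).1
  · rw [hgr]
    constructor
    · rintro rfl
      exact ⟨ζ - a ζ, (hg _ _).2 (by simp), by simp⟩
    · rintro ⟨η, hη, rfl⟩
      rw [hg] at hη
      simpa using hη

end BoundedTransform

/-! ### The regularisations (1 + ερ)⁻¹ and ρ_ε as functions of a. -/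

section Yosida

variable {H : Type*} [NormedAddCommGroup H] [InnerProductSpace ℂ H] [CompleteSpace H]

/-- At a spectral value t of a, ρ is t⁻¹ - 1, so (1 + ερ)⁻¹ and ρ_ε become t/(t + ε(1 - t)) and (1 -
t)/(t + ε(1 - t)). Cleared of t⁻¹, they are continuous on all of [0, 1], including t = 0. -/
theorem resolvent_denom_pos {t ε : ℝ} (ht : t ∈ Set.Icc 0 1) (hε : 0 < ε) :
    0 < t + ε * (1 - t) := by
  rcases ht.1.eq_or_lt with h | h
  · simp [← h, hε]
  · have := mul_nonneg hε.le (sub_nonneg.2 ht.2)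
    linarith

theorem continuousOn_resolventFun {ε : ℝ} (hε : 0 < ε) {g : ℝ → ℝ} (hg : Continuous g) :
    ContinuousOn (fun t : ℝ => g t / (t + ε * (1 - t))) (Set.Icc 0 1) :=
  hg.continuousOn.div (by fun_prop) fun _ ht => (resolvent_denom_pos ht hε).ne'

variable {a : H →L[ℂ] H} (h0 : 0 ≤ a) (h1 : a ≤ 1)
include h0 h1

theorem continuousOn_spectrum_resolventFun {ε : ℝ} (hε : 0 < ε) {g : ℝ → ℝ} (hg : Continuous g) :
    ContinuousOn (fun t : ℝ => g t / (t + ε * (1 - t))) (spectrum ℝ a) :=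
  (continuousOn_resolventFun hε hg).mono fun _ ht => spectrum_subset_Icc h0 h1 ht

theorem cfc_mul_denom {ε : ℝ} (hε : 0 < ε) {g : ℝ → ℝ} (hg : Continuous g) :
    cfc (fun t : ℝ => g t / (t + ε * (1 - t))) a * (a + (ε : ℂ) • (1 - a)) = cfc g a := by
  have hsa : IsSelfAdjoint a := .of_nonneg h0
  have e : a + (ε : ℂ) • (1 - a) = cfc (fun t : ℝ => t + ε * (1 - t)) a := by
    rw [cfc_add (a := a) (fun t : ℝ => t) (fun t : ℝ => ε * (1 - t)) (by fun_prop) (by fun_prop),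
      cfc_const_mul (a := a) ε (fun t : ℝ => 1 - t) (by fun_prop),
      cfc_sub (a := a) (fun _ : ℝ => 1) (fun t : ℝ => t) (by fun_prop) (by fun_prop),
      cfc_id' ℝ a, cfc_const_one ℝ a, Complex.coe_smul]
  rw [e, ← cfc_mul _ _ _ (continuousOn_spectrum_resolventFun h0 h1 hε hg) (by fun_prop)]
  exact cfc_congr fun t ht =>
    div_mul_cancel₀ _ (resolvent_denom_pos (spectrum_subset_Icc h0 h1 ht) hε).ne'

theorem cfc_resolventFun_eq_mul {ε : ℝ} (hε : 0 < ε) {g k : ℝ → ℝ} (hg : Continuous g)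
    (hk : Continuous k) :
    cfc (fun t : ℝ => k t * g t / (t + ε * (1 - t))) a =
      cfc k a * cfc (fun t : ℝ => g t / (t + ε * (1 - t))) a := by
  rw [← cfc_mul _ _ _ hk.continuousOn (continuousOn_spectrum_resolventFun h0 h1 hε hg)]
  simp only [mul_div_assoc]

/-- The operator a + ε(1 - a) has the two-sided inverse c, and it sends ξ + η to ξ + εη for (ξ, η)
in the graph; hence the resolvent is ac. -/
theorem IsResolvent.cfc {ρ : H →ₗ.[ℂ] H} (h : IsResolvent ρ 1 a) {ε : ℝ} (hε : 0 < ε) :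
    IsResolvent ρ ε (cfc (fun t : ℝ => t / (t + ε * (1 - t))) a) := by
  have hsa : IsSelfAdjoint a := .of_nonneg h0
  set c := _root_.cfc (fun t : ℝ => 1 / (t + ε * (1 - t))) a with hc
  have e1 : _root_.cfc (fun t : ℝ => t / (t + ε * (1 - t))) a = a * c := by
    have := cfc_resolventFun_eq_mul h0 h1 hε (g := fun _ => 1) (k := fun t => t)
      continuous_const continuous_id
    simpa only [mul_one, cfc_id' ℝ a] using this
  have e2 : c * (a + (ε : ℂ) • (1 - a)) = 1 := by
    rw [hc, cfc_mul_denom h0 h1 hε continuous_const, cfc_const_one ℝ a]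
  have hca : Commute a c := by
    have := cfc_commute_cfc (fun t : ℝ => t) (fun t : ℝ => 1 / (t + ε * (1 - t))) a
    rwa [cfc_id' ℝ a] at this
  have e3 : (a + (ε : ℂ) • (1 - a)) * c = 1 := by
    refine Eq.trans ?_ e2
    exact (hca.add_left (((Commute.one_left c).sub_left hca).smul_left _)).eq
  rw [e1]
  intro ζ ξ
  constructor
  · rintro rfl
    refine ⟨(1 - a) (c ζ), ?_, ?_⟩
    · rw [h.mem_graph_iff]
      simp
    · exact (DFunLike.congr_fun e3 ζ).symm
  · rintro ⟨η, hg, rfl⟩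
    rw [h.mem_graph_iff] at hg
    have e4 : ξ + (ε : ℂ) • η = (a + (ε : ℂ) • (1 - a)) (ξ + η) := by
      simp [hg]
    rw [e4]
    change a ((c * (a + (ε : ℂ) • (1 - a))) (ξ + η)) = ξ
    rw [e2, one_apply_eq_self, hg]

theorem IsResolvent.yosidaApprox_eq {ρ : H →ₗ.[ℂ] H} (h : IsResolvent ρ 1 a) {ε : ℝ}
    (hε : 0 < ε) :
    yosidaApprox ρ ε = _root_.cfc (fun t : ℝ => (1 - t) / (t + ε * (1 - t))) a := by
  have hsa : IsSelfAdjoint a := .of_nonneg h0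
  have hc : ContinuousOn (fun t : ℝ => t / (t + ε * (1 - t))) (spectrum ℝ a) :=
    continuousOn_spectrum_resolventFun h0 h1 hε continuous_id
  rw [yosidaApprox, (h.cfc h0 h1 hε).resolventOp_eq, ← cfc_const_one ℝ a,
    ← cfc_sub (a := a) (fun _ : ℝ => 1) _ (by fun_prop) hc, Complex.coe_smul,
    ← cfc_const_mul (a := a) ε⁻¹ (fun t : ℝ => 1 - t / (t + ε * (1 - t)))
      (continuousOn_const.sub hc)]
  refine cfc_congr fun t ht => ?_
  have := resolvent_denom_pos (spectrum_subset_Icc h0 h1 ht) hε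
  field_simp
  ring

theorem norm_cfc_resolventFun_le {ε : ℝ} (hε : 0 < ε) :
    ‖cfc (fun t : ℝ => t / (t + ε * (1 - t))) a‖ ≤ 1 := by
  refine norm_cfc_le zero_le_one fun t ht => ?_
  have ht' := spectrum_subset_Icc h0 h1 ht
  have := resolvent_denom_pos ht' hε
  rw [Real.norm_eq_abs, abs_of_nonneg (div_nonneg ht'.1 this.le), div_le_one this]
  nlinarith [mul_nonneg hε.le (sub_nonneg.2 ht'.2)]

/-- `(1 + ε ρ)⁻¹` converges strongly to `1` as `ε` decreases to `0`. -/
theorem tendsto_cfc_resolventFun (hinj : Function.Injective a) (η : H) :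
    Tendsto (fun ε : ℝ => cfc (fun t : ℝ => t / (t + ε * (1 - t))) a η) (𝓝[>] 0) (𝓝 η) := by
  have hsa : IsSelfAdjoint a := .of_nonneg h0
  rw [Metric.tendsto_nhds]
  intro r hr
  -- On the dense range of a convergence is quantitative, ‖(d - 1)a‖ ≤ ε, and elsewhere ‖d - 1‖ ≤ 2;
  -- the total error is below 2 · r/4 + r/2.
  obtain ⟨ζ, hζ⟩ := (denseRange_of_injective hsa hinj).exists_dist_lt η (ε := r / 4) (by positivity)
  have hlim : Tendsto (fun ε : ℝ => ε * ‖ζ‖) (𝓝[>] 0) (𝓝 0) := by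
    have : Tendsto (fun ε : ℝ => ε * ‖ζ‖) (𝓝 0) (𝓝 (0 * ‖ζ‖)) := tendsto_id.mul_const _
    rw [zero_mul] at this
    exact this.mono_left nhdsWithin_le_nhds
  filter_upwards [self_mem_nhdsWithin, hlim.eventually_lt_const (half_pos hr)] with ε hε hεr
  rw [Set.mem_Ioi] at hε
  set d := cfc (fun t : ℝ => t / (t + ε * (1 - t))) a with hd
  have hdn := norm_cfc_resolventFun_le h0 h1 hε
  rw [← hd] at hdn
  have e : (d - 1) * a = cfc (fun t : ℝ => -(ε * (1 - t) * t) / (t + ε * (1 - t))) a := by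
    have h2 := continuousOn_spectrum_resolventFun h0 h1 hε continuous_id
    simp only [id] at h2
    rw [hd, sub_mul, one_mul]
    have e1 : cfc (fun t : ℝ => t / (t + ε * (1 - t))) a * a =
        cfc (fun t : ℝ => t / (t + ε * (1 - t)) * t) a := by
      rw [cfc_mul _ _ _ h2 (by fun_prop), cfc_id' ℝ a]
    rw [e1]
    nth_rewrite 2 [← cfc_id' ℝ a]
    rw [← cfc_sub (a := a) (fun t : ℝ => t / (t + ε * (1 - t)) * t) (fun t => t)
      (h2.mul (by fun_prop)) (by fun_prop)]
    refine cfc_congr fun t ht => ?_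
    have := resolvent_denom_pos (spectrum_subset_Icc h0 h1 ht) hε
    field_simp
    ring
  have hn : ‖(d - 1) * a‖ ≤ ε := by
    rw [e]
    refine norm_cfc_le hε.le fun t ht => ?_
    have ht' := spectrum_subset_Icc h0 h1 ht
    have hp := resolvent_denom_pos ht' hε
    have h3 := mul_nonneg hε.le (sub_nonneg.2 ht'.2)
    rw [neg_div, norm_neg, Real.norm_eq_abs, abs_of_nonneg (div_nonneg (mul_nonneg h3 ht'.1) hp.le),
      div_le_iff₀ hp]
    nlinarith [mul_nonneg hε.le h3, mul_nonneg hε.le (mul_nonneg ht'.1 ht'.1)]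
  have hbd : ‖d - 1‖ ≤ 2 := by
    refine (norm_sub_le _ _).trans ?_
    have : ‖(1 : H →L[ℂ] H)‖ ≤ 1 := ContinuousLinearMap.norm_id_le
    linarith
  have hsplit : d η - η = (d - 1) (η - a ζ) + ((d - 1) * a) ζ := by
    simp only [map_sub, mul_apply_eq_comp, sub_apply, one_apply_eq_self]
    abel
  rw [dist_eq_norm, hsplit]
  have b1 := (d - 1).le_of_opNorm_le hbd (η - a ζ)
  have b2 := ((d - 1) * a).le_of_opNorm_le hn ζ
  rw [dist_eq_norm] at hζ
  calc _ ≤ _ := norm_add_le _ _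
    _ < r := by linarith

end Yosida

end

noncomputable section

/-! ### Existence and uniqueness of the density. -/

section Density

variable {H : Type*} [NormedAddCommGroup H] [InnerProductSpace ℂ H] [CompleteSpace H]
variable {A : VonNeumannAlgebra H} {τ φ ψ : A.toStarSubalgebra →ₗ[ℂ] ℂ}

theorem evalOp_coe (x : A.toStarSubalgebra) : evalOp A τ (x : H →L[ℂ] H) = τ x :=
  dif_pos x.2

theorem evalOp_of_mem {b : H →L[ℂ] H} (h : b ∈ A.toStarSubalgebra) : evalOp A τ b = τ ⟨b, h⟩ :=
  dif_pos h

/-- An element is injective if a faithful state factors through multiplication by it. -/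
theorem IsFaithfulNormalState.injective_of_eq_mul (hφ : IsFaithfulNormalState A φ)
    {b : A.toStarSubalgebra} (h : ∀ x, φ x = ψ (b * x)) :
    Function.Injective (b : H →L[ℂ] H) := by
  set K : Submodule ℂ H := (b : H →L[ℂ] H).ker with hK
  have hcl : IsClosed (K : Set H) := ContinuousLinearMap.isClosed_ker _
  have : CompleteSpace K := hcl.completeSpace_coe
  have hP : IsStarProjection K.starProjection := isStarProjection_starProjection
  -- The kernel of b is invariant under the commutant, so its projection p lies in A; then φ(p) =
  -- ψ(bp) = 0 forces p = 0.
  have hmem : K.starProjection ∈ A.toStarSubalgebra := by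
    refine (VonNeumannAlgebra.IsStarProjection.mem_iff hP A).2 fun y hy => ?_
    rw [Submodule.range_starProjection]
    intro ξ hξ
    have hξ' : (b : H →L[ℂ] H) ξ = 0 := hξ
    change (b : H →L[ℂ] H) (y ξ) = 0
    rw [← VonNeumannAlgebra.commutant_apply b.2 hy, hξ', map_zero]
  let p : A.toStarSubalgebra := ⟨K.starProjection, hmem⟩
  have hbp : b * p = 0 := by
    apply Subtype.ext
    ext ξ
    exact K.starProjection_apply_mem ξ
  have hpp : star p * p = p := by
    apply Subtype.ext
    change star K.starProjection * K.starProjection = K.starProjection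
    rw [hP.isSelfAdjoint.star_eq, hP.isIdempotentElem.eq]
  have hp0 : p = 0 := hφ.faithful p (by rw [hpp, h, hbp, map_zero])
  have hz : ∀ ξ, K.starProjection ξ = 0 := fun ξ =>
    DFunLike.congr_fun (congrArg Subtype.val hp0) ξ
  rw [injective_iff_map_eq_zero]
  intro ξ hξ
  rw [← hz ξ, Submodule.starProjection_eq_self_iff.2 hξ]

/-- `a` is the operator `(1 + ρ)⁻¹` for a density `ρ` of `φ`, described inside of `A`. -/
structure IsDensityTransform (A : VonNeumannAlgebra H) (τ φ : A.toStarSubalgebra →ₗ[ℂ] ℂ)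
    (a : A.toStarSubalgebra) : Prop where
  nonneg : 0 ≤ (a : H →L[ℂ] H)
  le_one : (a : H →L[ℂ] H) ≤ 1
  eq_mul : ∀ x, (τ + φ) (a * x) = τ x

theorem IsDensityTransform.injective {a : A.toStarSubalgebra} (ha : IsDensityTransform A τ φ a)
    (hτ : IsFaithfulNormalState A τ) : Function.Injective (a : H →L[ℂ] H) :=
  hτ.injective_of_eq_mul fun x => (ha.eq_mul x).symm

/-- The functional (τ + φ)((a - b) ·) vanishes. Testing it on (a - b)* leaves a sum of two
nonnegative terms, so the τ-term is zero and τ is faithful. -/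
theorem IsDensityTransform.eq {a b : A.toStarSubalgebra} (ha : IsDensityTransform A τ φ a)
    (hb : IsDensityTransform A τ φ b) (hτ : IsFaithfulNormalState A τ)
    (hφ : IsFaithfulNormalState A φ) : a = b := by
  have h : ∀ x, (τ + φ) ((a - b) * x) = 0 := fun x => by
    rw [sub_mul, map_sub, ha.eq_mul, hb.eq_mul, sub_self]
  have h1 := h (star (a - b))
  have h2 := congrArg Complex.re h1
  have e1 := hτ.nonneg (star (a - b))
  have e2 := hφ.nonneg (star (a - b))
  rw [star_star] at e1 e2
  simp only [LinearMap.add_apply, Complex.add_re, Complex.zero_re] at h2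
  have h3 : τ (star (star (a - b)) * star (a - b)) = 0 := by
    rw [star_star]
    exact Complex.ext (le_antisymm (by rw [Complex.zero_re]; linarith [e1.1, e2.1]) e1.1) e1.2
  have h4 := hτ.faithful _ h3
  rwa [star_eq_zero, sub_eq_zero] at h4

theorem exists_isDensityTransform (hτ : IsFaithfulNormalState A τ) (htr : IsTracial A τ)
    (hφ : IsFaithfulNormalState A φ) : ∃ a, IsDensityTransform A τ φ a := by
  have hψ := hτ.isPositiveNormal.add hφ.isPositiveNormal
  obtain ⟨a, h0, h1, h⟩ := hψ.exists_tracial_density hτ.isPositiveNormal htr fun x hx => by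
    simpa using hφ.isPositiveNormal.re_nonneg hx
  exact ⟨a, h0, h1, h⟩

theorem IsPositiveNormal.tendsto_cfc_resolventFun_mul (hφ : IsPositiveNormal A φ)
    {a : A.toStarSubalgebra} (h0 : 0 ≤ (a : H →L[ℂ] H)) (h1 : (a : H →L[ℂ] H) ≤ 1)
    (hinj : Function.Injective (a : H →L[ℂ] H)) (x : A.toStarSubalgebra) :
    Tendsto (fun ε : ℝ => φ (⟨cfc (fun t : ℝ => t / (t + ε * (1 - t))) (a : H →L[ℂ] H),
      VonNeumannAlgebra.cfc_mem a.2 _⟩ * x)) (𝓝[>] 0) (𝓝 (φ x)) := by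
  refine hφ.tendsto (C := 1 * ‖(x : H →L[ℂ] H)‖) ?_ fun ξ η => ?_
  · filter_upwards [self_mem_nhdsWithin] with ε hε
    exact (norm_mul_le _ _).trans
      (mul_le_mul_of_nonneg_right (norm_cfc_resolventFun_le h0 h1 hε) (norm_nonneg _))
  · exact tendsto_const_nhds.inner (tendsto_cfc_resolventFun h0 h1 hinj _)

/-- All these products are the function t(1 - t)/(t + ε(1 - t)) of a. A factor a thus trades ρ_ε,
unbounded as ε → 0, for the contractions (1 + ερ)⁻¹. -/
theorem cfc_one_sub_resolventFun {a : H →L[ℂ] H} (h0 : 0 ≤ a) (h1 : a ≤ 1) {ε : ℝ}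
    (hε : 0 < ε) :
    a * cfc (fun t : ℝ => (1 - t) / (t + ε * (1 - t))) a =
        cfc (fun t : ℝ => t / (t + ε * (1 - t))) a * (1 - a) ∧
      cfc (fun t : ℝ => (1 - t) / (t + ε * (1 - t))) a * a =
        cfc (fun t : ℝ => t / (t + ε * (1 - t))) a * (1 - a) := by
  have hsa : IsSelfAdjoint a := .of_nonneg h0
  have hc1 : ContinuousOn (fun t : ℝ => (1 - t) / (t + ε * (1 - t))) (spectrum ℝ a) :=
    continuousOn_spectrum_resolventFun h0 h1 hε (by fun_prop)
  have hc2 : ContinuousOn (fun t : ℝ => t / (t + ε * (1 - t))) (spectrum ℝ a) :=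
    continuousOn_spectrum_resolventFun h0 h1 hε continuous_id
  have e : cfc (fun t : ℝ => (1 - t) / (t + ε * (1 - t))) a * a =
      cfc (fun t : ℝ => t / (t + ε * (1 - t))) a * (1 - a) := by
    have e1 := cfc_mul (a := a) (fun t : ℝ => (1 - t) / (t + ε * (1 - t))) (fun t : ℝ => t)
      hc1 (by fun_prop)
    have e2 := cfc_mul (a := a) (fun t : ℝ => t / (t + ε * (1 - t))) (fun t : ℝ => 1 - t)
      hc2 (by fun_prop)
    rw [cfc_id' ℝ a] at e1
    rw [cfc_sub (a := a) (fun _ : ℝ => 1) (fun t : ℝ => t) (by fun_prop) (by fun_prop),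
      cfc_id' ℝ a, cfc_const_one ℝ a] at e2
    rw [← e1, ← e2]
    exact cfc_congr fun t _ => by ring
  refine ⟨?_, e⟩
  rw [← e]
  have := cfc_commute_cfc (fun t : ℝ => t) (fun t : ℝ => (1 - t) / (t + ε * (1 - t))) a
  rwa [cfc_id' ℝ a] at this

theorem IsDensityTransform.isDensity {a : A.toStarSubalgebra} (ha : IsDensityTransform A τ φ a)
    (hτ : IsFaithfulNormalState A τ) (hφ : IsFaithfulNormalState A φ) {ρ : H →ₗ.[ℂ] H}
    (hρ : IsPositiveOperator ρ) (hr : IsResolvent ρ 1 (a : H →L[ℂ] H)) :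
    IsDensity A τ φ ρ where
  positive := hρ
  nonsingular ξ hξ := by
    have hinj := hφ.injective_of_eq_mul (ψ := τ + φ) (b := 1 - a) fun x => by
      rw [sub_mul, map_sub, ha.eq_mul, one_mul, LinearMap.add_apply, add_sub_cancel_left]
    have hg := LinearPMap.mem_graph ρ ξ
    rw [hξ, hr.mem_graph_iff, add_zero] at hg
    apply Subtype.ext
    apply hinj
    change (ξ : H) - (a : H →L[ℂ] H) ξ = (1 - (a : H →L[ℂ] H)) (0 : ρ.domain)
    rw [hg]
    simp
  affiliated := hr.isAffiliated a.2
  eq_trace x := by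
    have hψ := hτ.isPositiveNormal.add hφ.isPositiveNormal
    have h := hψ.tendsto_cfc_resolventFun_mul ha.nonneg ha.le_one (ha.injective hτ) ((1 - a) * x)
    have e : (τ + φ) ((1 - a) * x) = φ x := by
      rw [sub_mul, map_sub, ha.eq_mul, one_mul, LinearMap.add_apply, add_sub_cancel_left]
    -- Here τ(ρ_ε x) = ψ(aρ_ε x) = ψ((1 + ερ)⁻¹(1 - a)x), which tends to ψ((1 - a)x) = φ(x).
    rw [e] at h
    refine h.congr' ?_
    filter_upwards [self_mem_nhdsWithin] with ε hε
    rw [Set.mem_Ioi] at hε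
    rw [hr.yosidaApprox_eq ha.nonneg ha.le_one hε, evalOp_of_mem (mul_mem
      (VonNeumannAlgebra.cfc_mem a.2 _) x.2), ← ha.eq_mul]
    congr 1
    apply Subtype.ext
    have := (cfc_one_sub_resolventFun ha.nonneg ha.le_one hε).1
    change cfc _ (a : H →L[ℂ] H) * ((1 - (a : H →L[ℂ] H)) * x) =
      (a : H →L[ℂ] H) * (cfc _ (a : H →L[ℂ] H) * x)
    rw [← mul_assoc, ← mul_assoc, this]

theorem IsDensity.isResolvent {ρ : H →ₗ.[ℂ] H} (hρ : IsDensity A τ φ ρ) :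
    IsResolvent ρ 1 (resolventOp ρ 1) :=
  hρ.positive.isResolvent_resolventOp one_pos

theorem IsDensity.resolventOp_mem {ρ : H →ₗ.[ℂ] H} (hρ : IsDensity A τ φ ρ) :
    resolventOp ρ 1 ∈ A.toStarSubalgebra :=
  hρ.affiliated.resolvent_mem hρ.isResolvent

/-- Evaluating the density formula at ax gives φ(ax) = lim τ(ρ_ε ax) = lim τ((1 + ερ)⁻¹(1 - a)x) =
τ((1 - a)x). -/
theorem IsDensity.isDensityTransform {ρ : H →ₗ.[ℂ] H} (hρ : IsDensity A τ φ ρ)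
    (hτ : IsFaithfulNormalState A τ) :
    IsDensityTransform A τ φ ⟨resolventOp ρ 1, hρ.resolventOp_mem⟩ := by
  have h0 := hρ.positive.resolvent_nonneg hρ.isResolvent
  have h1 := hρ.positive.resolvent_le_one hρ.isResolvent
  refine ⟨h0, h1, fun x => ?_⟩
  set a : A.toStarSubalgebra := ⟨resolventOp ρ 1, hρ.resolventOp_mem⟩ with ha
  have e : φ (a * x) = τ ((1 - a) * x) := by
    refine tendsto_nhds_unique (hρ.eq_trace (a * x)) ?_
    refine (hτ.isPositiveNormal.tendsto_cfc_resolventFun_mul (a := a) h0 h1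
      hρ.isResolvent.injective ((1 - a) * x)).congr' ?_
    filter_upwards [self_mem_nhdsWithin] with ε hε
    rw [Set.mem_Ioi] at hε
    rw [hρ.isResolvent.yosidaApprox_eq h0 h1 hε, evalOp_of_mem (mul_mem
      (VonNeumannAlgebra.cfc_mem a.2 _) (a * x).2)]
    congr 1
    apply Subtype.ext
    have := (cfc_one_sub_resolventFun h0 h1 hε).2
    change cfc _ (resolventOp ρ 1) * ((1 - resolventOp ρ 1) * (x : H →L[ℂ] H)) =
      cfc _ (resolventOp ρ 1) * (resolventOp ρ 1 * (x : H →L[ℂ] H))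
    rw [← mul_assoc, ← mul_assoc, this]
  rw [LinearMap.add_apply, e, sub_mul, map_sub, one_mul, add_sub_cancel]

theorem existsUnique_isDensity (hτ : IsFaithfulNormalState A τ) (htr : IsTracial A τ)
    (hφ : IsFaithfulNormalState A φ) : ∃! ρ : H →ₗ.[ℂ] H, IsDensity A τ φ ρ := by
  obtain ⟨a, ha⟩ := exists_isDensityTransform hτ htr hφ
  obtain ⟨ρ, hρ, hr⟩ := exists_isPositiveOperator ha.nonneg ha.le_one (ha.injective hτ)
  refine ⟨ρ, ha.isDensity hτ hφ hρ hr, fun σ hσ => ?_⟩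
  have hs := hσ.isResolvent
  have : resolventOp σ 1 = a :=
    congrArg Subtype.val ((hσ.isDensityTransform hτ).eq ha hτ hφ)
  rw [this] at hs
  exact eq_of_isResolvent hs hr

theorem isDensity_density (hτ : IsFaithfulNormalState A τ) (htr : IsTracial A τ)
    (hφ : IsFaithfulNormalState A φ) : IsDensity A τ φ (density A τ φ) :=
  Classical.epsilon_spec (existsUnique_isDensity hτ htr hφ).exists

end Density

end

noncomputable section

/-! ### Spectral measures from the Riesz-Markov-Kakutani theorem. -/

section SpectralMeasure

variable {H : Type*} [NormedAddCommGroup H] [InnerProductSpace ℂ H] [CompleteSpace H]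
variable {A : VonNeumannAlgebra H} {τ φ ψ : A.toStarSubalgebra →ₗ[ℂ] ℂ}

/-- The spectral measure of a positive contraction in a given state. -/
theorem IsFaithfulNormalState.exists_spectralMeasure (hτ : IsFaithfulNormalState A τ)
    (a : A.toStarSubalgebra) (h0 : 0 ≤ (a : H →L[ℂ] H)) (h1 : (a : H →L[ℂ] H) ≤ 1) :
    ∃ ν : Measure ℝ, IsProbabilityMeasure ν ∧ (∀ᵐ t ∂ν, t ∈ Set.Icc (0 : ℝ) 1) ∧
      ∀ f : ℝ → ℝ, ContinuousOn f (Set.Icc 0 1) →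
        τ ⟨cfc f (a : H →L[ℂ] H), VonNeumannAlgebra.cfc_mem a.2 f⟩ = ((∫ t, f t ∂ν : ℝ) : ℂ) := by
  have hsa : IsSelfAdjoint (a : H →L[ℂ] H) := .of_nonneg h0
  have hmem := VonNeumannAlgebra.cfcHom_mem a.2 hsa
  -- The representation theorem is applied on the compact spectrum, and the measure is then pushed
  -- forward to the line.
  let Λ₀ : CompactlySupportedContinuousMap (spectrum ℝ (a : H →L[ℂ] H)) ℝ →ₗ[ℝ] ℝ :=
    { toFun := fun g => (τ ⟨cfcHom hsa (g : C(_, ℝ)), hmem g⟩).re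
      map_add' := fun g k => by
        rw [← Complex.add_re, ← map_add]
        congr 2
        exact Subtype.ext (map_add (cfcHom hsa) (g : C(_, ℝ)) (k : C(_, ℝ)))
      map_smul' := fun r g => by
        rw [RingHom.id_apply, ← Complex.smul_re, ← LinearMap.map_smul_of_tower]
        congr 2
        exact Subtype.ext (map_smul (cfcHom hsa) r (g : C(_, ℝ))) }
  let Λ := PositiveLinearMap.mk₀ Λ₀ fun g hg =>
    hτ.isPositiveNormal.re_nonneg (cfcHom_nonneg_iff hsa |>.2 fun t => CompactlySupportedContinuousMap.le_def.1 hg t)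
  let κ := RealRMK.rieszMeasure Λ
  have hκ : ∀ g : C(spectrum ℝ (a : H →L[ℂ] H), ℝ),
      ∫ t, g t ∂κ = (τ ⟨cfcHom hsa g, hmem g⟩).re := fun g =>
    RealRMK.integral_rieszMeasure Λ (CompactlySupportedContinuousMap.continuousMapEquiv g)
  have hemb : MeasurableEmbedding ((↑) : spectrum ℝ (a : H →L[ℂ] H) → ℝ) :=
    MeasurableEmbedding.subtype_coe (spectrum.isClosed (𝕜 := ℝ) _).measurableSet
  have hint : ∀ f : ℝ → ℝ, ContinuousOn f (Set.Icc 0 1) →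
      τ ⟨cfc f (a : H →L[ℂ] H), VonNeumannAlgebra.cfc_mem a.2 f⟩ =
        ((∫ t, f t ∂(κ.map (↑)) : ℝ) : ℂ) := by
    intro f hf
    have hf' : ContinuousOn f (spectrum ℝ (a : H →L[ℂ] H)) :=
      hf.mono fun t ht => spectrum_subset_Icc h0 h1 ht
    rw [hemb.integral_map]
    have := hκ ⟨_, hf'.domRestrict⟩
    have e : ∀ t : spectrum ℝ (a : H →L[ℂ] H),
      (⟨_, hf'.domRestrict⟩ : C(spectrum ℝ (a : H →L[ℂ] H), ℝ)) t = f t := fun t => rfl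
    simp only [e] at this
    rw [this]
    have e2 : (⟨cfc f (a : H →L[ℂ] H), VonNeumannAlgebra.cfc_mem a.2 f⟩ : A.toStarSubalgebra) =
        ⟨cfcHom hsa ⟨_, hf'.domRestrict⟩, hmem _⟩ := Subtype.ext (cfc_apply f _ hsa hf')
    rw [e2]
    refine Complex.ext rfl ?_
    rw [Complex.ofReal_im]
    refine hτ.isPositiveNormal.im_eq_zero (Subtype.ext ?_)
    change star (cfcHom hsa _) = cfcHom hsa _
    rw [← map_star, star_trivial]
  have hone := hint (fun _ => 1) continuousOn_const
  have hfin : IsFiniteMeasure (κ.map ((↑) : spectrum ℝ (a : H →L[ℂ] H) → ℝ)) := by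
    have : IsFiniteMeasure κ := inferInstance
    infer_instance
  refine ⟨κ.map (↑), ⟨?_⟩, ?_, hint⟩
  · have e : (⟨cfc (fun _ : ℝ => (1 : ℝ)) (a : H →L[ℂ] H), VonNeumannAlgebra.cfc_mem a.2 _⟩ :
        A.toStarSubalgebra) = 1 := Subtype.ext (cfc_const_one ℝ (a : H →L[ℂ] H))
    rw [e, hτ.map_one, integral_const, smul_eq_mul, mul_one] at hone
    have h2 : (κ.map ((↑) : spectrum ℝ (a : H →L[ℂ] H) → ℝ)).real Set.univ = 1 := by
      exact_mod_cast hone.symm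
    rwa [Measure.real, ENNReal.toReal_eq_one_iff] at h2
  · rw [hemb.ae_map_iff]
    exact Eventually.of_forall fun t => spectrum_subset_Icc h0 h1 t.2

theorem IsSpectralDistribution.eq {ρ : H →ₗ.[ℂ] H} {μ ν : Measure ℝ}
    (hμ : IsSpectralDistribution A τ ρ μ) (hν : IsSpectralDistribution A τ ρ ν) : μ = ν := by
  have := hμ.isProbability
  have := hν.isProbability
  refine Measure.ext_of_integral_eq_on_compactlySupported fun f => ?_
  have h := (hμ.integral_eq f f.continuous f.hasCompactSupport).symm.trans
    (hν.integral_eq f f.continuous f.hasCompactSupport)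
  exact_mod_cast h

theorem IsSpectralDistribution.spectralDistribution_eq {ρ : H →ₗ.[ℂ] H} {μ : Measure ℝ}
    (hμ : IsSpectralDistribution A τ ρ μ) : spectralDistribution A τ ρ = μ :=
  (Classical.epsilon_spec (p := IsSpectralDistribution A τ ρ) ⟨μ, hμ⟩ :
    IsSpectralDistribution A τ ρ (spectralDistribution A τ ρ)).eq hμ

end SpectralMeasure

/-! ### The change of variable s = t⁻¹ - 1. -/

section CayleyTransform

/-- As t → 0 the point t⁻¹ - 1 leaves every compact set, so g vanishes there and the value 0 at t =
0 is the continuous one. -/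
theorem continuous_compactSupport_comp_inv {g : ℝ → ℝ} (hg : Continuous g)
    (hc : HasCompactSupport g) :
    Continuous fun t : ℝ => if t = 0 then 0 else g (t⁻¹ - 1) := by
  rw [continuous_iff_continuousAt]
  intro t
  by_cases ht : t = 0
  · subst ht
    have h1 : Tendsto (fun t : ℝ => t⁻¹ - 1) (𝓝[≠] 0) (cocompact ℝ) := by
      have : Tendsto (fun s : ℝ => s - 1) (cocompact ℝ) (cocompact ℝ) :=
        (Homeomorph.subRight (1 : ℝ)).isClosedEmbedding.tendsto_cocompact
      refine this.comp ?_
      simpa using tendsto_inv₀_nhdsNE_zero (α := ℝ)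
    have h2 : Tendsto g (cocompact ℝ) (𝓝 0) := hc.is_zero_at_infty
    rw [continuousAt_iff_punctured_nhds, if_pos rfl]
    refine (h2.comp h1).congr' ?_
    filter_upwards [self_mem_nhdsWithin] with t ht
    rw [if_neg (by simpa using ht), Function.comp_apply]
  · have h : ContinuousAt (fun t : ℝ => g (t⁻¹ - 1)) t :=
      hg.continuousAt.comp ((continuousAt_inv₀ ht).sub continuousAt_const)
    refine h.congr ?_
    filter_upwards [isOpen_ne.mem_nhds ht] with s hs
    rw [if_neg hs]

variable {H : Type*} [NormedAddCommGroup H] [InnerProductSpace ℂ H] [CompleteSpace H]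
variable {A : VonNeumannAlgebra H} {τ φ ψ : A.toStarSubalgebra →ₗ[ℂ] ℂ}

/-- The hypothesis ν {0} = 0 is essential: with 0⁻¹ = 0 the map sends t = 0 to -1, while `funcCalc`
assigns the value 0 there. -/
theorem isSpectralDistribution_map {ρ : H →ₗ.[ℂ] H} {a : A.toStarSubalgebra}
    (ha : resolventOp ρ 1 = a) {ν : Measure ℝ} (hν : IsProbabilityMeasure ν) (hν0 : ν {0} = 0)
    (hint : ∀ f : ℝ → ℝ, Continuous f →
      τ ⟨cfc f (a : H →L[ℂ] H), VonNeumannAlgebra.cfc_mem a.2 f⟩ = ((∫ t, f t ∂ν : ℝ) : ℂ)) :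
    IsSpectralDistribution A τ ρ (ν.map fun t => t⁻¹ - 1) where
  isProbability := Measure.isProbabilityMeasure_map (by fun_prop)
  integral_eq g hg hc := by
    rw [integral_map (by fun_prop) hg.aestronglyMeasurable, funcCalc, ha,
      evalOp_of_mem (VonNeumannAlgebra.cfc_mem a.2 _),
      hint _ (continuous_compactSupport_comp_inv hg hc)]
    congr 1
    refine integral_congr_ae ?_
    have : ∀ᵐ t ∂ν, t ≠ 0 := by
      rw [ae_iff]
      simpa using hν0
    filter_upwards [this] with t ht
    rw [if_neg ht]

end CayleyTransform

/-! ### The inequality s log s ≥ s - 1 and its equality case. -/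

section KullbackLeibler

open InformationTheory

variable {μ : Measure ℝ} [IsProbabilityMeasure μ]

/-- From `klFun s = s log s + 1 - s ≥ 0` one gets -s log s ≤ 1 - s ≤ 1, so the extended integral is
never of the form ∞ - ∞. -/
theorem lintegral_neg_mul_log_ne_top (h0 : ∀ᵐ s ∂μ, 0 ≤ s) :
    ∫⁻ s, ENNReal.ofReal (-(s * Real.log s)) ∂μ ≠ ⊤ := by
  refine ne_top_of_le_ne_top (b := ∫⁻ _, 1 ∂μ) (by simp) (lintegral_mono_ae ?_)
  filter_upwards [h0] with s hs
  have := klFun_nonneg hs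
  rw [klFun_apply] at this
  rw [← ENNReal.ofReal_one]
  exact ENNReal.ofReal_le_ofReal (by linarith)

theorem extIntegral_eq_top (h0 : ∀ᵐ s ∂μ, 0 ≤ s)
    (h : ∫⁻ s, ENNReal.ofReal (s * Real.log s) ∂μ = ⊤) :
    extIntegral μ (fun s => s * Real.log s) = ⊤ := by
  have := lintegral_neg_mul_log_ne_top h0
  rw [extIntegral, h, EReal.coe_ennreal_top]
  lift ∫⁻ s, ENNReal.ofReal (-(s * Real.log s)) ∂μ to NNReal using this with r
  rfl

/-- The correction 1 - s has integral 0, because μ has mass 1 and mean 1. -/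
theorem extIntegral_eq_integral_klFun (h0 : ∀ᵐ s ∂μ, 0 ≤ s)
    (h : ∫⁻ s, ENNReal.ofReal (s * Real.log s) ∂μ ≠ ⊤) (hi : Integrable (fun s => s) μ)
    (h1 : ∫ s, s ∂μ = 1) :
    Integrable klFun μ ∧
      extIntegral μ (fun s => s * Real.log s) = ((∫ s, klFun s ∂μ : ℝ) : EReal) := by
  have hn := lintegral_neg_mul_log_ne_top h0
  have hf : Integrable (fun s : ℝ => s * Real.log s) μ := by
    refine ⟨Real.continuous_mul_log.aestronglyMeasurable, ?_⟩
    rw [hasFiniteIntegral_iff_norm]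
    have : ∀ s : ℝ, ENNReal.ofReal ‖s * Real.log s‖ ≤
        ENNReal.ofReal (s * Real.log s) + ENNReal.ofReal (-(s * Real.log s)) := fun s => by
      rw [Real.norm_eq_abs]
      rcases abs_cases (s * Real.log s) with ⟨e, _⟩ | ⟨e, _⟩ <;> rw [e] <;> simp
    refine (lintegral_mono this).trans_lt ?_
    rw [lintegral_add_left (by fun_prop)]
    exact ENNReal.add_lt_top.2 ⟨h.lt_top, hn.lt_top⟩
  have hk : Integrable klFun μ := (hf.add (integrable_const 1)).sub hi
  refine ⟨hk, ?_⟩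
  have e : ∫ s, klFun s ∂μ = ∫ s, s * Real.log s ∂μ := by
    have : ∫ s, klFun s ∂μ = ∫ s, (s * Real.log s + 1 - s) ∂μ := rfl
    rw [this, integral_sub (f := fun s => s * Real.log s + 1) (hf.add (integrable_const 1)) hi,
      integral_add hf (integrable_const 1), h1]
    simp
  rw [e, integral_eq_lintegral_pos_part_sub_lintegral_neg_part hf, extIntegral, EReal.coe_sub]
  lift ∫⁻ s, ENNReal.ofReal (s * Real.log s) ∂μ to NNReal using h with p
  lift ∫⁻ s, ENNReal.ofReal (-(s * Real.log s)) ∂μ to NNReal using hn with q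
  rfl

theorem extIntegral_mul_log_nonneg (h0 : ∀ᵐ s ∂μ, 0 ≤ s) (hi : Integrable (fun s => s) μ)
    (h1 : ∫ s, s ∂μ = 1) : 0 ≤ extIntegral μ (fun s => s * Real.log s) := by
  by_cases h : ∫⁻ s, ENNReal.ofReal (s * Real.log s) ∂μ = ⊤
  · rw [extIntegral_eq_top h0 h]
    exact le_top
  · rw [(extIntegral_eq_integral_klFun h0 h hi h1).2]
    exact_mod_cast integral_nonneg_of_ae (h0.mono fun s hs => klFun_nonneg hs)

theorem ae_eq_one_of_extIntegral_mul_log_eq_zero (h0 : ∀ᵐ s ∂μ, 0 ≤ s)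
    (hi : Integrable (fun s => s) μ) (h1 : ∫ s, s ∂μ = 1)
    (hz : extIntegral μ (fun s => s * Real.log s) = 0) : ∀ᵐ s ∂μ, s = 1 := by
  by_cases h : ∫⁻ s, ENNReal.ofReal (s * Real.log s) ∂μ = ⊤
  · rw [extIntegral_eq_top h0 h] at hz
    exact absurd hz EReal.top_ne_zero
  · obtain ⟨hk, e⟩ := extIntegral_eq_integral_klFun h0 h hi h1
    rw [e] at hz
    have hz' : ∫ s, klFun s ∂μ = 0 := by exact_mod_cast hz
    have := (integral_eq_zero_iff_of_nonneg_ae (h0.mono fun s hs => klFun_nonneg hs) hk).1 hz'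
    filter_upwards [this, h0] with s hs hs0
    exact (klFun_eq_zero_iff hs0).1 hs

end KullbackLeibler

end

noncomputable section

/-! ### The sign of the entropy and the case of equality. -/

section Entropy

variable {H : Type*} [NormedAddCommGroup H] [InnerProductSpace ℂ H] [CompleteSpace H]
variable {A : VonNeumannAlgebra H} {τ φ ψ : A.toStarSubalgebra →ₗ[ℂ] ℂ}

theorem tendsto_one_div_nat_nhdsGT :
    Tendsto (fun n : ℕ => 1 / ((n : ℝ) + 1)) atTop (𝓝[>] 0) :=
  tendsto_nhdsWithin_iff.2 ⟨tendsto_one_div_add_atTop_nhds_zero_nat,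
    Eventually.of_forall fun n => by
      rw [Set.mem_Ioi]
      positivity⟩

/-- The functions t/(t + ε(1 - t)) tend to the indicator of t ≠ 0, so their integrals tend to 1 - ν
{0}; by injectivity of a and normality the same quantities tend to τ(1) = 1. -/
theorem IsFaithfulNormalState.spectralMeasure_zero (hτ : IsFaithfulNormalState A τ)
    {a : A.toStarSubalgebra} (h0 : 0 ≤ (a : H →L[ℂ] H)) (h1 : (a : H →L[ℂ] H) ≤ 1)
    (hinj : Function.Injective (a : H →L[ℂ] H)) {ν : Measure ℝ} [IsProbabilityMeasure ν]
    (hν : ∀ᵐ t ∂ν, t ∈ Set.Icc (0 : ℝ) 1)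
    (hint : ∀ f : ℝ → ℝ, ContinuousOn f (Set.Icc 0 1) →
      τ ⟨cfc f (a : H →L[ℂ] H), VonNeumannAlgebra.cfc_mem a.2 f⟩ = ((∫ t, f t ∂ν : ℝ) : ℂ)) :
    ν {0} = 0 := by
  have hlim1 := (hτ.isPositiveNormal.tendsto_cfc_resolventFun_mul h0 h1 hinj 1).comp
    tendsto_one_div_nat_nhdsGT
  have hlim2 : Tendsto (fun n : ℕ => ∫ t, t / (t + 1 / ((n : ℝ) + 1) * (1 - t)) ∂ν) atTop
      (𝓝 1) := by
    have h := (Complex.continuous_re.tendsto _).comp hlim1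
    rw [hτ.map_one, Complex.one_re] at h
    refine h.congr fun n => ?_
    have hn : (0 : ℝ) < 1 / ((n : ℝ) + 1) := by positivity
    simp only [Function.comp_apply, mul_one]
    rw [hint (fun t => t / (t + 1 / ((n : ℝ) + 1) * (1 - t)))
      (continuousOn_resolventFun hn continuous_id)]
    rfl
  have hlim3 : Tendsto (fun n : ℕ => ∫ t, t / (t + 1 / ((n : ℝ) + 1) * (1 - t)) ∂ν) atTop
      (𝓝 (∫ t, ({0}ᶜ : Set ℝ).indicator (fun _ => (1 : ℝ)) t ∂ν)) := by
    refine tendsto_integral_of_dominated_convergence (fun _ => 1) (fun n => ?_)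
      (integrable_const _) (fun n => ?_) ?_
    · exact (Measurable.div (by fun_prop) (by fun_prop)).aestronglyMeasurable
    · filter_upwards [hν] with t ht
      have hn : (0 : ℝ) < 1 / ((n : ℝ) + 1) := by positivity
      have hp := resolvent_denom_pos ht hn
      rw [Real.norm_eq_abs, abs_of_nonneg (div_nonneg ht.1 hp.le), div_le_one hp]
      nlinarith [mul_nonneg hn.le (sub_nonneg.2 ht.2)]
    · refine Eventually.of_forall fun t => ?_
      by_cases ht : t = 0
      · simp [ht]
      · rw [Set.indicator_of_mem (by simpa using ht)]
        have : Tendsto (fun ε : ℝ => t / (t + ε * (1 - t))) (𝓝[>] 0)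
            (𝓝 (t / (t + 0 * (1 - t)))) := by
          refine Tendsto.mono_left (ContinuousAt.tendsto (f := fun ε : ℝ => t / (t + ε * (1 - t)))
            ?_) nhdsWithin_le_nhds
          exact ContinuousAt.div (by fun_prop) (by fun_prop) (by simpa using ht)
        rw [zero_mul, add_zero, div_self ht] at this
        exact this.comp tendsto_one_div_nat_nhdsGT
  have h := tendsto_nhds_unique hlim3 hlim2
  rw [integral_indicator (measurableSet_singleton _).compl, setIntegral_const, smul_eq_mul,
    mul_one, measureReal_compl (measurableSet_singleton _), probReal_univ, sub_eq_self] at h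
  simpa [measureReal_eq_zero_iff] using h

/-- This is φ(1) = 1: the numbers τ(ρ_ε) are integrals of (1 - t)/(t + ε(1 - t)), which increase to
t⁻¹ - 1, and monotone convergence applies along ε = 1/(n + 1). -/
theorem IsDensity.lintegral_spectralMeasure {ρ : H →ₗ.[ℂ] H} (hρ : IsDensity A τ φ ρ)
    (hφ : IsFaithfulNormalState A φ)
    {a : A.toStarSubalgebra} (h0 : 0 ≤ (a : H →L[ℂ] H)) (h1 : (a : H →L[ℂ] H) ≤ 1)
    (hr : IsResolvent ρ 1 (a : H →L[ℂ] H)) {ν : Measure ℝ} [IsProbabilityMeasure ν]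
    (hν : ∀ᵐ t ∂ν, t ∈ Set.Icc (0 : ℝ) 1) (hν0 : ν {0} = 0)
    (hint : ∀ f : ℝ → ℝ, ContinuousOn f (Set.Icc 0 1) →
      τ ⟨cfc f (a : H →L[ℂ] H), VonNeumannAlgebra.cfc_mem a.2 f⟩ = ((∫ t, f t ∂ν : ℝ) : ℂ)) :
    ∫⁻ t, ENNReal.ofReal (t⁻¹ - 1) ∂ν = 1 := by
  have hν0' : ∀ᵐ t ∂ν, t ≠ 0 := by
    rw [ae_iff]
    simpa using hν0
  have hlim1 : Tendsto (fun n : ℕ => ∫ t, (1 - t) / (t + 1 / ((n : ℝ) + 1) * (1 - t)) ∂ν) atTop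
      (𝓝 1) := by
    have h := ((Complex.continuous_re.tendsto _).comp (hρ.eq_trace 1)).comp
      tendsto_one_div_nat_nhdsGT
    rw [hφ.map_one, Complex.one_re] at h
    refine h.congr fun n => ?_
    have hn : (0 : ℝ) < 1 / ((n : ℝ) + 1) := by positivity
    simp only [Function.comp_apply]
    rw [hr.yosidaApprox_eq h0 h1 hn, OneMemClass.coe_one, mul_one,
      evalOp_of_mem (VonNeumannAlgebra.cfc_mem a.2 _),
      hint _ (continuousOn_resolventFun hn (by fun_prop))]
    rfl
  have hnonneg : ∀ n : ℕ, ∀ t ∈ Set.Icc (0 : ℝ) 1,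
      0 ≤ (1 - t) / (t + 1 / ((n : ℝ) + 1) * (1 - t)) := fun n t ht =>
    div_nonneg (sub_nonneg.2 ht.2) (resolvent_denom_pos ht (by positivity)).le
  have hlim2 : Tendsto (fun n : ℕ =>
      ∫⁻ t, ENNReal.ofReal ((1 - t) / (t + 1 / ((n : ℝ) + 1) * (1 - t))) ∂ν) atTop (𝓝 1) := by
    rw [← ENNReal.ofReal_one]
    refine ((ENNReal.continuous_ofReal.tendsto _).comp hlim1).congr fun n => ?_
    have hn : (0 : ℝ) < 1 / ((n : ℝ) + 1) := by positivity
    refine ofReal_integral_eq_lintegral_ofReal ?_ (hν.mono fun t ht => hnonneg n t ht)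
    refine Integrable.of_bound (C := (n : ℝ) + 1)
      (Measurable.div (by fun_prop) (by fun_prop)).aestronglyMeasurable ?_
    filter_upwards [hν] with t ht
    rw [Real.norm_eq_abs, abs_of_nonneg (hnonneg n t ht),
      div_le_iff₀ (resolvent_denom_pos ht hn), mul_add, ← mul_assoc, mul_one_div_cancel
      (by positivity)]
    nlinarith [mul_nonneg (by positivity : (0 : ℝ) ≤ n + 1) ht.1]
  refine tendsto_nhds_unique (lintegral_tendsto_of_tendsto_of_monotone
    (fun n => (Measurable.ennreal_ofReal (Measurable.div (by fun_prop) (by fun_prop))).aemeasurable)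
    ?_ ?_) hlim2
  · filter_upwards [hν] with t ht
    intro m n hmn
    refine ENNReal.ofReal_le_ofReal ?_
    refine div_le_div_of_nonneg_left (sub_nonneg.2 ht.2)
      (resolvent_denom_pos ht (by positivity)) ?_
    have h2 : (m : ℝ) ≤ n := by exact_mod_cast hmn
    have := one_div_le_one_div_of_le (by positivity : (0 : ℝ) < (m : ℝ) + 1)
      (by linarith : (m : ℝ) + 1 ≤ n + 1)
    have := mul_le_mul_of_nonneg_right this (sub_nonneg.2 ht.2)
    linarith
  · filter_upwards [hν0'] with t ht
    refine (ENNReal.continuous_ofReal.tendsto _).comp ?_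
    have : Tendsto (fun ε : ℝ => (1 - t) / (t + ε * (1 - t))) (𝓝[>] 0)
        (𝓝 ((1 - t) / (t + 0 * (1 - t)))) := by
      refine Tendsto.mono_left
        (ContinuousAt.tendsto (f := fun ε : ℝ => (1 - t) / (t + ε * (1 - t))) ?_)
        nhdsWithin_le_nhds
      exact ContinuousAt.div (by fun_prop) (by fun_prop) (by simpa using ht)
    rw [zero_mul, add_zero, sub_div, div_self ht, one_div] at this
    exact this.comp tendsto_one_div_nat_nhdsGT

/-- The spectral distribution of a density, as an image of the spectral measure of
`(1 + ρ)⁻¹`. -/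
theorem IsDensity.exists_spectralMeasure {ρ : H →ₗ.[ℂ] H} (hρ : IsDensity A τ φ ρ)
    (hτ : IsFaithfulNormalState A τ) (hφ : IsFaithfulNormalState A φ)
    {a : A.toStarSubalgebra} (ha : resolventOp ρ 1 = a) :
    ∃ ν : Measure ℝ, IsProbabilityMeasure ν ∧ (∀ᵐ t ∂ν, t ∈ Set.Icc (0 : ℝ) 1) ∧ ν {0} = 0 ∧
      (∀ f : ℝ → ℝ, ContinuousOn f (Set.Icc 0 1) →
        τ ⟨cfc f (a : H →L[ℂ] H), VonNeumannAlgebra.cfc_mem a.2 f⟩ = ((∫ t, f t ∂ν : ℝ) : ℂ)) ∧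
      spectralDistribution A τ ρ = ν.map (fun t => t⁻¹ - 1) ∧
      ∫⁻ t, ENNReal.ofReal (t⁻¹ - 1) ∂ν = 1 := by
  have hr := hρ.isResolvent
  rw [ha] at hr
  have h0 := hρ.positive.resolvent_nonneg hr
  have h1 := hρ.positive.resolvent_le_one hr
  obtain ⟨ν, hp, hν, hint⟩ := hτ.exists_spectralMeasure a h0 h1
  have hν0 := hτ.spectralMeasure_zero h0 h1 hr.injective hν hint
  exact ⟨ν, hp, hν, hν0, hint, (isSpectralDistribution_map ha hp hν0 fun f hf =>
    hint f hf.continuousOn).spectralDistribution_eq,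
    hρ.lintegral_spectralMeasure hφ h0 h1 hr hν hν0 hint⟩

theorem spectralDistribution_properties {ν : Measure ℝ} (hp : IsProbabilityMeasure ν)
    (hν : ∀ᵐ t ∂ν, t ∈ Set.Icc (0 : ℝ) 1) (hν0 : ν {0} = 0)
    (h : ∫⁻ t, ENNReal.ofReal (t⁻¹ - 1) ∂ν = 1) :
    IsProbabilityMeasure (ν.map fun t => t⁻¹ - 1) ∧ (∀ᵐ s ∂(ν.map fun t => t⁻¹ - 1), 0 ≤ s) ∧
      Integrable (fun s => s) (ν.map fun t => t⁻¹ - 1) ∧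
      ∫ s, s ∂(ν.map fun t => t⁻¹ - 1) = 1 := by
  have hm : Measurable fun t : ℝ => t⁻¹ - 1 := by fun_prop
  have hν0' : ∀ᵐ t ∂ν, t ≠ 0 := by
    rw [ae_iff]
    simpa using hν0
  have hpos : ∀ᵐ s ∂(ν.map fun t => t⁻¹ - 1), 0 ≤ s := by
    rw [ae_map_iff hm.aemeasurable measurableSet_Ici]
    filter_upwards [hν, hν0'] with t ht ht0
    rw [sub_nonneg]
    exact (one_le_inv₀ (lt_of_le_of_ne ht.1 (Ne.symm ht0))).2 ht.2
  have hl : ∫⁻ s, ENNReal.ofReal s ∂(ν.map fun t => t⁻¹ - 1) = 1 := by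
    rwa [lintegral_map ENNReal.measurable_ofReal hm]
  have hi : Integrable (fun s => s) (ν.map fun t => t⁻¹ - 1) := by
    refine ⟨measurable_id.aestronglyMeasurable, ?_⟩
    rw [hasFiniteIntegral_iff_ofReal hpos, hl]
    exact ENNReal.one_lt_top
  refine ⟨Measure.isProbabilityMeasure_map hm.aemeasurable, hpos, hi, ?_⟩
  rw [integral_eq_lintegral_of_nonneg_ae hpos hi.aestronglyMeasurable, hl, ENNReal.toReal_one]

theorem entropy_nonpos (hτ : IsFaithfulNormalState A τ) (htr : IsTracial A τ)
    (hφ : IsFaithfulNormalState A φ) : entropy A τ φ ≤ 0 := by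
  have hρ := isDensity_density hτ htr hφ
  obtain ⟨ν, hp, hν, hν0, -, hs, hl⟩ :=
    hρ.exists_spectralMeasure hτ hφ (a := ⟨_, hρ.resolventOp_mem⟩) rfl
  obtain ⟨hμ, h1, h2, h3⟩ := spectralDistribution_properties hp hν hν0 hl
  rw [entropy, EReal.neg_le_zero, traceOf, hs]
  exact extIntegral_mul_log_nonneg h1 h2 h3

/-- The density of τ is ρ = 1, whose transform is (1 + 1)⁻¹. -/
theorem half_isDensityTransform : IsDensityTransform A τ τ (algebraMap ℝ _ (1 / 2)) where
  nonneg := by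
    change (0 : H →L[ℂ] H) ≤ algebraMap ℝ (H →L[ℂ] H) (1 / 2)
    exact algebraMap_nonneg _ (by norm_num)
  le_one := by
    change algebraMap ℝ (H →L[ℂ] H) (1 / 2) ≤ 1
    rw [← map_one (algebraMap ℝ (H →L[ℂ] H))]
    exact algebraMap_mono _ (by norm_num)
  eq_mul x := by
    rw [← Algebra.smul_def, LinearMap.map_smul_of_tower, LinearMap.add_apply, ← two_smul ℝ,
      smul_smul]
    norm_num

theorem entropy_self (hτ : IsFaithfulNormalState A τ) (htr : IsTracial A τ) :
    entropy A τ τ = 0 := by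
  have hρ := isDensity_density hτ htr hτ
  set ρ := density A τ τ with hρdef
  have ha : resolventOp ρ 1 = (algebraMap ℝ A.toStarSubalgebra (1 / 2) : A.toStarSubalgebra) :=
    congrArg Subtype.val ((hρ.isDensityTransform hτ).eq half_isDensityTransform hτ hτ)
  have hs : spectralDistribution A τ ρ = Measure.dirac 1 := by
    refine IsSpectralDistribution.spectralDistribution_eq ⟨inferInstance, fun g hg hc => ?_⟩
    have ha' : resolventOp ρ 1 = algebraMap ℝ (H →L[ℂ] H) (1 / 2) := ha
    rw [integral_dirac, funcCalc, ha', cfc_algebraMap, if_neg (by norm_num)]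
    have e : algebraMap ℝ (H →L[ℂ] H) (g ((1 / 2)⁻¹ - 1)) =
        (algebraMap ℝ A.toStarSubalgebra (g 1) : A.toStarSubalgebra) := by
      norm_num
      rfl
    rw [e, evalOp_coe, Algebra.algebraMap_eq_smul_one, LinearMap.map_smul_of_tower, hτ.map_one]
    simp
  rw [entropy, traceOf, hs, extIntegral]
  simp

theorem eq_of_entropy_eq_zero (hτ : IsFaithfulNormalState A τ) (htr : IsTracial A τ)
    (hφ : IsFaithfulNormalState A φ) (h : entropy A τ φ = 0) : φ = τ := by
  have hρ := isDensity_density hτ htr hφ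
  set ρ := density A τ φ with hρdef
  set a : A.toStarSubalgebra := ⟨_, hρ.resolventOp_mem⟩ with ha
  obtain ⟨ν, hp, hν, hν0, hint, hs, hl⟩ := hρ.exists_spectralMeasure hτ hφ (a := a) rfl
  obtain ⟨hμ, h1, h2, h3⟩ := spectralDistribution_properties hp hν hν0 hl
  have hsa : IsSelfAdjoint (a : H →L[ℂ] H) :=
    .of_nonneg (hρ.positive.resolvent_nonneg hρ.isResolvent)
  rw [entropy, EReal.neg_eq_zero_iff, traceOf, ← hρdef, hs] at h
  have hae := ae_eq_one_of_extIntegral_mul_log_eq_zero h1 h2 h3 h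
  replace hae := ae_of_ae_map (by fun_prop) hae
  -- The value s = 1 corresponds to t = 1/2, so τ((a - 1/2)²) = 0 and faithfulness gives a = 1/2.
  have hsq := hint (fun t => (t - 1 / 2) * (t - 1 / 2)) (by fun_prop)
  have hz : ∫ t, (t - 1 / 2) * (t - 1 / 2) ∂ν = 0 := by
    refine integral_eq_zero_of_ae ?_
    filter_upwards [hae] with t ht
    have : t = 1 / 2 := by
      have e : t⁻¹ = 2 := by linarith
      rw [← inv_inv t, e, one_div]
    simp [this]
  rw [hz] at hsq
  set b : A.toStarSubalgebra := a - algebraMap ℝ _ (1 / 2) with hb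
  have hb' : (b : H →L[ℂ] H) = cfc (fun t : ℝ => t - 1 / 2) (a : H →L[ℂ] H) := by
    rw [cfc_sub (a := (a : H →L[ℂ] H)) (fun t : ℝ => t) (fun _ => 1 / 2) (by fun_prop)
      (by fun_prop), cfc_id' ℝ (a : H →L[ℂ] H), cfc_const _ (a : H →L[ℂ] H)]
    rfl
  have hbb : star b * b = ⟨cfc (fun t : ℝ => (t - 1 / 2) * (t - 1 / 2)) (a : H →L[ℂ] H),
      VonNeumannAlgebra.cfc_mem a.2 _⟩ := by
    apply Subtype.ext
    have hbsa : star (b : H →L[ℂ] H) = b := by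
      rw [hb']
      exact IsSelfAdjoint.star_eq (cfc_predicate _ _)
    change star (b : H →L[ℂ] H) * b =
      cfc (fun t : ℝ => (t - 1 / 2) * (t - 1 / 2)) (a : H →L[ℂ] H)
    rw [hbsa, cfc_mul (a := (a : H →L[ℂ] H)) (fun t : ℝ => t - 1 / 2) (fun t : ℝ => t - 1 / 2)
      (by fun_prop) (by fun_prop), hb']
  have hb0 := hτ.faithful b (by rw [hbb, hsq, Complex.ofReal_zero])
  have hah : a = algebraMap ℝ _ (1 / 2) := sub_eq_zero.1 hb0
  have hda := (hρ.isDensityTransform hτ).eq_mul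
  ext x
  have := hda x
  rw [← ha, hah, ← Algebra.smul_def, LinearMap.map_smul_of_tower, LinearMap.add_apply] at this
  have e : ((1 / 2 : ℝ) : ℂ) * (τ x + φ x) = τ x := by
    rwa [← Complex.real_smul]
  push_cast at e
  linear_combination 2 * e

end Entropy

end

noncomputable section

/-! ### Functional calculus on eigenvectors. -/

section Eigenvectors

variable {H : Type*} [NormedAddCommGroup H] [InnerProductSpace ℂ H]

theorem mem_spectrum_of_apply_eq_smul {a : H →L[ℂ] H} {t : ℝ} {v : H} (hv : v ≠ 0)
    (h : a v = t • v) : t ∈ spectrum ℝ a := by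
  rw [spectrum.mem_iff]
  intro hu
  obtain ⟨c, hc⟩ := hu.exists_left_inv
  have : (c * (algebraMap ℝ (H →L[ℂ] H) t - a)) v = v := by
    rw [hc]
    rfl
  apply hv
  rw [← this]
  change c ((algebraMap ℝ (H →L[ℂ] H) t - a) v) = 0
  have e : (algebraMap ℝ (H →L[ℂ] H) t - a) v = t • v - a v := by
    rw [Algebra.algebraMap_eq_smul_one]
    rfl
  rw [e, h, sub_self, map_zero]

theorem cfc_apply_eigenvector [CompleteSpace H] {a : H →L[ℂ] H} (ha : IsSelfAdjoint a) {t : ℝ} {v : H}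
    (h : a v = t • v) {f : ℝ → ℝ} (hf : ContinuousOn f (spectrum ℝ a)) :
    cfc f a v = f t • v := by
  by_cases hv : v = 0
  · simp [hv]
  have ht := mem_spectrum_of_apply_eq_smul hv h
  rw [cfc_apply f a ha hf]
  suffices ∀ g : C(spectrum ℝ a, ℝ), cfcHom ha g v = g ⟨t, ht⟩ • v from this _
  intro g
  induction g using ContinuousMap.induction_on_of_compact with
  | const r =>
    have : cfcHom ha (ContinuousMap.const _ r) = algebraMap ℝ _ r :=
      AlgHomClass.commutes (cfcHom ha) r
    rw [this, Algebra.algebraMap_eq_smul_one]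
    rfl
  | id =>
    rw [cfcHom_id ha]
    exact h
  | star_id =>
    rw [star_trivial, cfcHom_id ha]
    exact h
  | add f g hf hg =>
    rw [map_add, add_apply, hf, hg, ← add_smul]
    rfl
  | mul f g hf hg =>
    rw [map_mul]
    change cfcHom ha f (cfcHom ha g v) = _
    rw [hg, ContinuousLinearMap.map_smul_of_tower, hf, smul_smul, mul_comm]
    rfl
  | frequently f hf =>
    have hcl : IsClosed {g : C(spectrum ℝ a, ℝ) | cfcHom ha g v = g ⟨t, ht⟩ • v} := by
      have h1 : Continuous fun g : C(spectrum ℝ a, ℝ) => cfcHom ha g := cfcHom_continuous ha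
      have h2 : Continuous fun g : C(spectrum ℝ a, ℝ) => g ⟨t, ht⟩ :=
        by fun_prop
      exact isClosed_eq (by fun_prop) (by fun_prop)
    exact hcl.mem_of_frequently_of_tendsto hf tendsto_id

end Eigenvectors

/-! ### Diagonal operators and their normal states. -/

section DiagonalAlgebra

variable {H : Type*} [NormedAddCommGroup H] [InnerProductSpace ℂ H]

/-- The projection onto the line spanned by a basis vector. -/
def basisProj (b : HilbertBasis ℕ ℂ H) (n : ℕ) : H →L[ℂ] H :=
  InnerProductSpace.rankOne ℂ (b n) (b n)

theorem basisProj_apply (b : HilbertBasis ℕ ℂ H) (n : ℕ) (v : H) :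
    basisProj b n v = inner ℂ (b n) v • b n := rfl

theorem basisProj_basis (b : HilbertBasis ℕ ℂ H) (n m : ℕ) :
    basisProj b n (b m) = if n = m then b m else 0 := by
  rw [basisProj_apply, orthonormal_iff_ite.1 b.orthonormal]
  split_ifs with h
  · rw [h, one_smul]
  · rw [zero_smul]

/-- The diagonal entries of an operator. -/
def diagEntry (b : HilbertBasis ℕ ℂ H) (x : H →L[ℂ] H) (n : ℕ) : ℂ := inner ℂ (b n) (x (b n))

theorem norm_diagEntry_le {b : HilbertBasis ℕ ℂ H} (x : H →L[ℂ] H) (n : ℕ) : ‖diagEntry b x n‖ ≤ ‖x‖ := by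
  have h1 := b.orthonormal.1 n
  refine (norm_inner_le_norm _ _).trans ?_
  rw [h1, one_mul]
  simpa [h1] using x.le_opNorm (b n)

theorem diagEntry_one {b : HilbertBasis ℕ ℂ H} (n : ℕ) : diagEntry b 1 n = 1 := by
  rw [diagEntry, one_apply_eq_self, inner_self_eq_norm_sq_to_K, b.orthonormal.1 n]
  simp

theorem diagEntry_basisProj {b : HilbertBasis ℕ ℂ H} (n m : ℕ) :
    diagEntry b (basisProj b n) m = if n = m then 1 else 0 := by
  rw [diagEntry, basisProj_basis]
  split_ifs with h
  · exact diagEntry_one m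
  · exact inner_zero_right _

theorem eq_zero_of_forall_apply_basis {b : HilbertBasis ℕ ℂ H} {x : H →L[ℂ] H} (h : ∀ n, x (b n) = 0) : x = 0 := by
  refine ContinuousLinearMap.ext_on (s := Set.range b) ?_ ?_
  · exact (Submodule.dense_iff_topologicalClosure_eq_top).2 b.dense_span
  · rintro _ ⟨n, rfl⟩
    exact h n

theorem summable_weight_mul {b : HilbertBasis ℕ ℂ H} {w : ℕ → ℝ} (hw : Summable w) (h0 : ∀ n, 0 < w n) (x : H →L[ℂ] H) :
    Summable fun n => (w n : ℂ) * diagEntry b x n := by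
  refine Summable.of_norm_bounded (hw.mul_right ‖x‖) fun n => ?_
  rw [norm_mul, Complex.norm_real, Real.norm_eq_abs, abs_of_pos (h0 n)]
  exact mul_le_mul_of_nonneg_left (norm_diagEntry_le x n) (h0 n).le

variable [CompleteSpace H]

theorem star_basisProj (b : HilbertBasis ℕ ℂ H) (n : ℕ) : star (basisProj b n) = basisProj b n := by
  rw [ContinuousLinearMap.star_eq_adjoint, basisProj, InnerProductSpace.adjoint_rankOne]

/-- The algebra of diagonal operators with respect to a Hilbert basis. -/
def diagonalAlgebra (b : HilbertBasis ℕ ℂ H) : VonNeumannAlgebra H where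
  toStarSubalgebra := StarSubalgebra.centralizer ℂ (Set.range (basisProj b))
  centralizer_centralizer' := Set.centralizer_centralizer_centralizer _

theorem mem_diagonalAlgebra {b : HilbertBasis ℕ ℂ H} {x : H →L[ℂ] H} :
    x ∈ (diagonalAlgebra b).toStarSubalgebra ↔ ∀ n, basisProj b n * x = x * basisProj b n := by
  change x ∈ StarSubalgebra.centralizer ℂ (Set.range (basisProj b)) ↔ _
  rw [StarSubalgebra.mem_centralizer_iff]
  constructor
  · exact fun h n => (h _ ⟨n, rfl⟩).1
  · rintro h _ ⟨n, rfl⟩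
    rw [star_basisProj]
    exact ⟨h n, h n⟩

theorem basisProj_mem (b : HilbertBasis ℕ ℂ H) (n : ℕ) :
    basisProj b n ∈ (diagonalAlgebra b).toStarSubalgebra := by
  rw [mem_diagonalAlgebra]
  intro m
  by_cases h : m = n
  · rw [h]
  · ext v
    change basisProj b m (basisProj b n v) = basisProj b n (basisProj b m v)
    rw [basisProj_apply b n, basisProj_apply b m v, map_smul, map_smul, basisProj_basis,
      basisProj_basis, if_neg h, if_neg (Ne.symm h), smul_zero, smul_zero]

variable {b : HilbertBasis ℕ ℂ H}

theorem apply_basis (x : (diagonalAlgebra b).toStarSubalgebra) (n : ℕ) :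
    (x : H →L[ℂ] H) (b n) = diagEntry b x n • b n := by
  have := DFunLike.congr_fun (mem_diagonalAlgebra.1 x.2 n) (b n)
  change basisProj b n ((x : H →L[ℂ] H) (b n)) = (x : H →L[ℂ] H) (basisProj b n (b n)) at this
  rw [basisProj_basis, if_pos rfl, basisProj_apply] at this
  exact this.symm

theorem diagEntry_mul (x y : (diagonalAlgebra b).toStarSubalgebra) (n : ℕ) :
    diagEntry b ((x * y : (diagonalAlgebra b).toStarSubalgebra) : H →L[ℂ] H) n =
      diagEntry b x n * diagEntry b y n := by
  change inner ℂ (b n) ((x : H →L[ℂ] H) ((y : H →L[ℂ] H) (b n))) = _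
  rw [apply_basis y, map_smul, inner_smul_right, mul_comm]
  rfl

theorem diagEntry_star_mul_self (x : H →L[ℂ] H) (n : ℕ) :
    diagEntry b (star x * x) n = ((‖x (b n)‖ ^ 2 : ℝ) : ℂ) := by
  change inner ℂ (b n) (star x (x (b n))) = _
  rw [ContinuousLinearMap.star_eq_adjoint, ContinuousLinearMap.adjoint_inner_right,
    inner_self_eq_norm_sq_to_K]
  simp

/-- The functional `x ↦ ∑ₙ wₙ xₙₙ` on the algebra of diagonal operators. -/
def diagonalState (b : HilbertBasis ℕ ℂ H) (w : ℕ → ℝ) (hw : Summable w) (h0 : ∀ n, 0 < w n) :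
    (diagonalAlgebra b).toStarSubalgebra →ₗ[ℂ] ℂ where
  toFun x := ∑' n, (w n : ℂ) * diagEntry b x n
  map_add' x y := by
    rw [← (summable_weight_mul hw h0 _).tsum_add (summable_weight_mul hw h0 _)]
    refine tsum_congr fun n => ?_
    rw [← mul_add]
    congr 1
    exact inner_add_right _ _ _
  map_smul' c x := by
    rw [RingHom.id_apply, smul_eq_mul, ← tsum_mul_left]
    refine tsum_congr fun n => ?_
    have : diagEntry b ((c • x : (diagonalAlgebra b).toStarSubalgebra) : H →L[ℂ] H) n =
      c * diagEntry b x n := inner_smul_right _ _ _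
    rw [this]
    ring

theorem diagonalState_apply {w : ℕ → ℝ} (hw : Summable w) (h0 : ∀ n, 0 < w n)
    (x : (diagonalAlgebra b).toStarSubalgebra) :
    diagonalState b w hw h0 x = ∑' n, (w n : ℂ) * diagEntry b x n := rfl

theorem isTracial_diagonalState {w : ℕ → ℝ} (hw : Summable w) (h0 : ∀ n, 0 < w n) :
    IsTracial (diagonalAlgebra b) (diagonalState b w hw h0) := fun x y => by
  rw [diagonalState_apply, diagonalState_apply]
  simp only [diagEntry_mul, mul_comm (diagEntry b x _)]

theorem diagonalState_mul_basisProj {w : ℕ → ℝ} (hw : Summable w) (h0 : ∀ n, 0 < w n)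
    (x : (diagonalAlgebra b).toStarSubalgebra) (n : ℕ) :
    diagonalState b w hw h0 (x * ⟨basisProj b n, basisProj_mem b n⟩) = w n * diagEntry b x n := by
  rw [diagonalState_apply, tsum_eq_single n]
  · rw [diagEntry_mul, diagEntry_basisProj, if_pos rfl, mul_one]
  · intro m hm
    rw [diagEntry_mul, diagEntry_basisProj, if_neg (Ne.symm hm), mul_zero, mul_zero]

theorem diagonalState_star_mul_self {w : ℕ → ℝ} (hw : Summable w) (h0 : ∀ n, 0 < w n)
    (x : (diagonalAlgebra b).toStarSubalgebra) :
    diagonalState b w hw h0 (star x * x) =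
      ((∑' n, w n * ‖(x : H →L[ℂ] H) (b n)‖ ^ 2 : ℝ) : ℂ) := by
  rw [diagonalState_apply, Complex.ofReal_tsum]
  refine tsum_congr fun n => ?_
  rw [Complex.ofReal_mul, ← diagEntry_star_mul_self]
  rfl

theorem isFaithfulNormalState_diagonalState {w : ℕ → ℝ} (hw : HasSum w 1) (h0 : ∀ n, 0 < w n) :
    IsFaithfulNormalState (diagonalAlgebra b) (diagonalState b w hw.summable h0) where
  nonneg x := by
    rw [diagonalState_star_mul_self]
    refine ⟨?_, Complex.ofReal_im _⟩
    rw [Complex.ofReal_re]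
    exact tsum_nonneg fun n => mul_nonneg (h0 n).le (by positivity)
  map_one := by
    have : ∀ n, (w n : ℂ) * diagEntry b
        ((1 : (diagonalAlgebra b).toStarSubalgebra) : H →L[ℂ] H) n = w n := fun n => by
      rw [OneMemClass.coe_one, diagEntry_one, mul_one]
    rw [diagonalState_apply, tsum_congr this, ← Complex.ofReal_tsum, hw.tsum_eq,
      Complex.ofReal_one]
  faithful x hx := by
    have hs : Summable fun n => w n * ‖(x : H →L[ℂ] H) (b n)‖ ^ 2 := by
      refine Summable.of_nonneg_of_le (fun n => mul_nonneg (h0 n).le (by positivity)) (fun n => ?_)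
        (hw.summable.mul_right (‖(x : H →L[ℂ] H)‖ ^ 2))
      have h1 := (x : H →L[ℂ] H).le_opNorm (b n)
      rw [b.orthonormal.1 n, mul_one] at h1
      exact mul_le_mul_of_nonneg_left (by gcongr) (h0 n).le
    rw [diagonalState_star_mul_self] at hx
    have hz : ∑' n, w n * ‖(x : H →L[ℂ] H) (b n)‖ ^ 2 = 0 := by exact_mod_cast hx
    have hz' := (hasSum_zero_iff_of_nonneg
      fun n => mul_nonneg (h0 n).le (by positivity)).1 (hz ▸ hs.hasSum)
    refine Subtype.ext (eq_zero_of_forall_apply_basis (b := b) fun n => ?_)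
    have := congrFun hz' n
    rw [Pi.zero_apply, mul_eq_zero, or_iff_right (h0 n).ne'] at this
    simpa using this
  normal := by
    -- With ξₙ = √wₙ bₙ the state is one of the functionals that define the σ-weak topology; Σ ‖ξₙ‖²
    -- = Σ wₙ is finite.
    let ξ : lp (fun _ : ℕ => H) 2 := ⟨fun n => ((√(w n) : ℝ) : ℂ) • b n, by
      refine memℓp_gen ?_
      refine hw.summable.congr fun n => ?_
      rw [norm_smul, b.orthonormal.1 n, Complex.norm_real, mul_one]
      simp [Real.sq_sqrt (h0 n).le]⟩
    have e : ⇑(diagonalState b w hw.summable h0) =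
        fun x : (diagonalAlgebra b).toStarSubalgebra =>
          ∑' n, inner ℂ (ξ n) ((x : H →L[ℂ] H) (ξ n)) := by
      ext x
      rw [diagonalState_apply]
      refine tsum_congr fun n => ?_
      change _ = inner ℂ (((√(w n) : ℝ) : ℂ) • b n) ((x : H →L[ℂ] H) (((√(w n) : ℝ) : ℂ) • b n))
      rw [map_smul, inner_smul_left, inner_smul_right, Complex.conj_ofReal, ← mul_assoc,
        ← Complex.ofReal_mul, Real.mul_self_sqrt (h0 n).le]
      rfl
    rw [e]
    exact continuous_iInf_dom (i := ξ) (continuous_iInf_dom (i := ξ) continuous_induced_dom)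

end DiagonalAlgebra

end

noncomputable section

/-! ### A diagonal example with entropy -∞. -/

section DiagonalEntropy

variable {H : Type*} [NormedAddCommGroup H] [InnerProductSpace ℂ H] [CompleteSpace H]
variable {b : HilbertBasis ℕ ℂ H} {w p : ℕ → ℝ}

/-- Testing `eq_mul` on the n-th basis projection gives (wₙ + pₙ)aₙ = wₙ for the diagonal entry aₙ.
Thus ρ has eigenvalue pₙ/wₙ on bₙ. -/
theorem resolvent_apply_basis (hw : HasSum w 1) (hp : HasSum p 1)
    (hw0 : ∀ n, 0 < w n) (hp0 : ∀ n, 0 < p n) {a : (diagonalAlgebra b).toStarSubalgebra}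
    (ha : IsDensityTransform (diagonalAlgebra b) (diagonalState b w hw.summable hw0)
      (diagonalState b p hp.summable hp0) a) (n : ℕ) :
    (a : H →L[ℂ] H) (b n) = (w n / (w n + p n)) • b n := by
  have h := ha.eq_mul ⟨basisProj b n, basisProj_mem b n⟩
  have h1 := diagonalState_mul_basisProj hw.summable hw0 (1 : (diagonalAlgebra b).toStarSubalgebra) n
  rw [one_mul, OneMemClass.coe_one, diagEntry_one, mul_one] at h1
  rw [LinearMap.add_apply, diagonalState_mul_basisProj, diagonalState_mul_basisProj, h1,
    ← add_mul] at h
  have hne : (w n : ℂ) + p n ≠ 0 := by exact_mod_cast (add_pos (hw0 n) (hp0 n)).ne'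
  rw [apply_basis, ← Complex.coe_smul, Complex.ofReal_div, Complex.ofReal_add,
    ← eq_div_of_mul_eq hne ((mul_comm _ _).trans h)]

theorem isSpectralDistribution_diagonal (hw : HasSum w 1) (hp : HasSum p 1)
    (hw0 : ∀ n, 0 < w n) (hp0 : ∀ n, 0 < p n) {ρ : H →ₗ.[ℂ] H}
    (hρ : IsDensity (diagonalAlgebra b) (diagonalState b w hw.summable hw0)
      (diagonalState b p hp.summable hp0) ρ) :
    IsSpectralDistribution (diagonalAlgebra b) (diagonalState b w hw.summable hw0) ρ
      (Measure.sum fun n => ENNReal.ofReal (w n) • Measure.dirac (p n / w n)) := by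
  have hτ := isFaithfulNormalState_diagonalState (b := b) hw hw0
  have ha := hρ.isDensityTransform hτ
  have hsa : IsSelfAdjoint (resolventOp ρ 1) := .of_nonneg ha.nonneg
  have hsum : ∑' n, ENNReal.ofReal (w n) = 1 := by
    rw [← ENNReal.ofReal_tsum_of_nonneg (fun n => (hw0 n).le) hw.summable, hw.tsum_eq,
      ENNReal.ofReal_one]
  refine ⟨⟨?_⟩, fun g hg hc => ?_⟩
  · rw [Measure.sum_apply _ MeasurableSet.univ]
    simpa using hsum
  · rw [integral_sum_dirac fun _ => ENNReal.ofReal_ne_top, funcCalc,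
      evalOp_of_mem (VonNeumannAlgebra.cfc_mem hρ.resolventOp_mem _), diagonalState_apply,
      Complex.ofReal_tsum]
    refine tsum_congr fun n => ?_
    have e := cfc_apply_eigenvector hsa (resolvent_apply_basis hw hp hw0 hp0 ha n)
      (continuous_compactSupport_comp_inv hg hc).continuousOn
    have hne : w n / (w n + p n) ≠ 0 := (div_pos (hw0 n) (add_pos (hw0 n) (hp0 n))).ne'
    have hr : (w n / (w n + p n))⁻¹ - 1 = p n / w n := by
      have := (hw0 n).ne'
      rw [inv_div]
      field_simp
      ring
    rw [if_neg hne, hr] at e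
    rw [ENNReal.toReal_ofReal (hw0 n).le, smul_eq_mul, Complex.ofReal_mul, diagEntry, e,
      ← Complex.coe_smul, inner_smul_right, inner_self_eq_norm_sq_to_K, b.orthonormal.1 n]
    simp

theorem entropy_diagonal_eq_bot (hw : HasSum w 1) (hp : HasSum p 1)
    (hw0 : ∀ n, 0 < w n) (hp0 : ∀ n, 0 < p n)
    (htop : ∑' n, ENNReal.ofReal (p n * Real.log (p n / w n)) = ⊤) :
    entropy (diagonalAlgebra b) (diagonalState b w hw.summable hw0)
      (diagonalState b p hp.summable hp0) = ⊥ := by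
  have hτ := isFaithfulNormalState_diagonalState (b := b) hw hw0
  have hφ := isFaithfulNormalState_diagonalState (b := b) hp hp0
  have hρ := isDensity_density hτ (isTracial_diagonalState _ _) hφ
  have hμ := isSpectralDistribution_diagonal hw hp hw0 hp0 hρ
  have := hμ.isProbability
  rw [entropy, traceOf, hμ.spectralDistribution_eq, extIntegral_eq_top, EReal.neg_top]
  · refine Measure.ae_sum_iff.2 fun n => ?_
    refine Measure.ae_smul_measure ?_ _
    rw [ae_dirac_eq]
    exact div_nonneg (hp0 n).le (hw0 n).le
  · rw [lintegral_sum_measure, ← htop]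
    refine tsum_congr fun n => ?_
    rw [lintegral_smul_measure, lintegral_dirac, smul_eq_mul, ← ENNReal.ofReal_mul (hw0 n).le,
      ← mul_assoc, mul_div_cancel₀ _ (hw0 n).ne']

/-- Two probability vectors with infinite relative entropy. -/
theorem exists_infinite_relative_entropy :
    ∃ w p : ℕ → ℝ, HasSum w 1 ∧ HasSum p 1 ∧ (∀ n, 0 < w n) ∧ (∀ n, 0 < p n) ∧
      ∑' n, ENNReal.ofReal (p n * Real.log (p n / w n)) = ⊤ := by
  obtain ⟨p, hp, hp0⟩ : ∃ p : ℕ → ℝ, HasSum p 1 ∧ ∀ n, 0 < p n :=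
    ⟨fun n => 1 / 2 / 2 ^ n, hasSum_geometric_two' 1, fun n => by positivity⟩
  -- Taking wₙ = pₙ exp(-1/pₙ)/V with V the normalising sum makes pₙ log(pₙ/wₙ) = 1 + pₙ log V,
  -- which tends to 1, so the series diverges.
  have hv0 : ∀ n, 0 < p n * Real.exp (-(p n)⁻¹) := fun n => mul_pos (hp0 n) (Real.exp_pos _)
  have hv : Summable fun n => p n * Real.exp (-(p n)⁻¹) := by
    refine Summable.of_nonneg_of_le (fun n => (hv0 n).le) (fun n => ?_) hp.summable
    refine mul_le_of_le_one_right (hp0 n).le (Real.exp_le_one_iff.2 ?_)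
    have := hp0 n
    simp [this.le]
  set V := ∑' n, p n * Real.exp (-(p n)⁻¹) with hV
  have hV0 : 0 < V := hv.tsum_pos (fun n => (hv0 n).le) 0 (hv0 0)
  refine ⟨fun n => p n * Real.exp (-(p n)⁻¹) / V, p, ?_, hp, fun n => div_pos (hv0 n) hV0, hp0, ?_⟩
  · have := hv.hasSum.div_const V
    rwa [← hV, div_self hV0.ne'] at this
  · have e : ∀ n, p n * Real.log (p n / (p n * Real.exp (-(p n)⁻¹) / V)) =
        p n * Real.log V + 1 := fun n => by
      have h1 := (hp0 n).ne'
      have h2 : p n / (p n * Real.exp (-(p n)⁻¹) / V) = V * Real.exp (p n)⁻¹ := by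
        rw [Real.exp_neg]
        have := (Real.exp_pos (p n)⁻¹).ne'
        field_simp
      rw [h2, Real.log_mul hV0.ne' (Real.exp_pos _).ne', Real.log_exp, mul_add, mul_inv_cancel₀ h1]
    simp only [e]
    by_contra hne
    have h1 := ENNReal.tendsto_atTop_zero_of_tsum_ne_top hne
    have h2 : Tendsto (fun n => ENNReal.ofReal (p n * Real.log V + 1)) atTop
        (𝓝 (ENNReal.ofReal (0 * Real.log V + 1))) :=
      (ENNReal.continuous_ofReal.tendsto _).comp
        ((hp.summable.tendsto_atTop_zero.mul_const _).add_const 1)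
    have h3 := tendsto_nhds_unique h1 h2
    simp at h3

end DiagonalEntropy

end

theorem mainTheorem11 :
    (∀ (H : Type*) [NormedAddCommGroup H] [InnerProductSpace ℂ H] [CompleteSpace H]
      (A : VonNeumannAlgebra H) (τ φ : A.toStarSubalgebra →ₗ[ℂ] ℂ),
      IsFaithfulNormalState A τ → IsTracial A τ → IsFaithfulNormalState A φ →
        (∃! ρ : H →ₗ.[ℂ] H, IsDensity A τ φ ρ) ∧
        entropy A τ φ ≤ 0 ∧
        (entropy A τ φ = 0 ↔ φ = τ)) ∧
    (∃ (H : Type) (_ : NormedAddCommGroup H) (_ : InnerProductSpace ℂ H) (_ : CompleteSpace H)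
      (A : VonNeumannAlgebra H) (τ φ : A.toStarSubalgebra →ₗ[ℂ] ℂ),
      IsFaithfulNormalState A τ ∧ IsTracial A τ ∧ IsFaithfulNormalState A φ ∧
        entropy A τ φ = ⊥) := by
  refine ⟨fun H _ _ _ A τ φ hτ htr hφ => ⟨existsUnique_isDensity hτ htr hφ,
    entropy_nonpos hτ htr hφ, eq_of_entropy_eq_zero hτ htr hφ, ?_⟩, ?_⟩
  · rintro rfl
    exact entropy_self hτ htr
  · obtain ⟨w, p, hw, hp, hw0, hp0, htop⟩ := exists_infinite_relative_entropy
    let b : HilbertBasis ℕ ℂ (lp (fun _ : ℕ => ℂ) 2) := default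
    exact ⟨lp (fun _ : ℕ => ℂ) 2, inferInstance, inferInstance, inferInstance, diagonalAlgebra b,
      diagonalState b w hw.summable hw0, diagonalState b p hp.summable hp0,
      isFaithfulNormalState_diagonalState hw hw0, isTracial_diagonalState _ _,
      isFaithfulNormalState_diagonalState hp hp0, entropy_diagonal_eq_bot hw hp hw0 hp0 htop⟩
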